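/- Let $\mathcal{M}$ be a bicomplete model category, $K$ a set of cofibrant objects of $\mathcal{M}$, and $T$ a monad on $\mathcal{M}$ such that the category $\mathrm{Alg}(T;\mathcal{M})$ of $T$-algebras is cocomplete (hence bicomplete); write $U$ for the forgetful functor and $T:\mathcal{M}\to \mathrm{Alg}(T;\mathcal{M})$ for its left adjoint, the free algebra functor. Mapping spaces $\mathrm{map}(X,A)$ are right homotopy function complexes: the simplicial set of maps from a cofibrant object $X$ into a simplicial resolution of $A$ (or, in a semi-model category, of an object weakly equivalent to $A$), i.e. a Reedy fibrant simplicial object that is levelwise weakly equivalent to the constant one. A map $f:A\to B$ is a $K$-colocal equivalence if $\mathrm{map}(X,A)\to\mathrm{map}(X,B)$ is a weak equivalence of simplicial sets for all $X\in K$; a cofibrant object $Y$ is $K$-colocal if $\mathrm{map}(Y,A)\to\mathrm{map}(Y,B)$ is a weak equivalence for all $K$-colocal equivalences $A\to B$. $R_K\mathcal{M}$ denotes the category $\mathcal{M}$ with the $K$-colocal equivalences as weak equivalences, with the fibrations of $\mathcal{M}$, and with the maps having the left lifting property against trivial fibrations as cofibrations. The same definitions are used for the set $T(K)$ of free algebras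 on objects of $K$ in $\mathrm{Alg}(T;\mathcal{M})$. A semi-model category over a category $\mathcal{B}$ with weak equivalences, fibrations and cofibrations is a bicomplete category $\mathcal{D}$ with a right adjoint $U:\mathcal{D}\to\mathcal{B}$ and three classes of maps (weak equivalences, fibrations, cofibrations) such that: (1) $U$ preserves and reflects fibrations and trivial fibrations; (2) weak equivalences satisfy 2-out-of-3, and the three classes are closed under retracts; (3) cofibrations have the left lifting property against trivial fibrations, and trivial cofibrations with cofibrant domain have it against fibrations; (4) every map factors functorially as a cofibration followed by a trivial fibration, and every map with cofibrant domain factors functorially as a trivial cofibration followed by a fibration; (5) $U$ of the initial object is cofibrant in $\mathcal{B}$; (6) fibrations and trivial fibrations are closed under pullback. "Cofibrant" in (3) and (4) means cofibrant in $\mathcal{D}$. For $\mathcal{B}=\mathcal{M}$ or $\mathcal{B}=R_K\mathcal{M}$, the category $\mathrm{Alg}(T;\mathcal{B})$ is semi-admissible over $\mathcal{B}$ if it is a semi-model category over $\mathcal{B}$ in which $f$ is a weak equivalence (fibration) if and only if $Uf$ is one in $\mathcal{B}$, and the cofibrations are the maps having the left lifting property against trivial fibrations. **Corollary.** Suppose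 that $R_K\mathcal{M}$ is a model category, that $\mathrm{Alg}(T;\mathcal{M})$ is semi-admissible over $\mathcal{M}$, and that one of the following two (equivalent) conditions holds: (i) $\mathrm{Alg}(T;R_K\mathcal{M})$ is semi-admissible over $R_K\mathcal{M}$; (ii) $R_{T(K)}\mathrm{Alg}(T;\mathcal{M})$ is a semi-model category (over $R_K\mathcal{M}$). Then the free functor $T:\mathcal{M}\to\mathrm{Alg}(T;\mathcal{M})$ sends $K$-colocal equivalences between $K$-colocal objects to $T(K)$-colocal equivalences between $T(K)$-colocal objects: if $f:X\to Y$ is a $K$-colocal equivalence and $X$, $Y$ are $K$-colocal, then $TX$ and $TY$ are $T(K)$-colocal and $Tf$ is a $T(K)$-colocal equivalence. -/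

import Mathlib

open CategoryTheory CategoryTheory.Limits HomotopicalAlgebra Opposite

universe v u u'

namespace Colocal

/-! ## Weak equivalences of simplicial sets -/

/-- A map `f : X ⟶ Y` of simplicial sets is a weak (homotopy) equivalence if for every Kan
complex `Z`, precomposition with `f` induces a bijection `[Y, Z] ≃ [X, Z]` on simplicial homotopy
classes of maps. (Simplicial homotopy is an equivalence relation, as `Z` is a Kan complex.) -/
def SSetWeakEquivalence {X Y : SSet.{v}} (f : X ⟶ Y) : Prop :=
  ∀ (Z : SSet.{v}), SSet.KanComplex Z →
    (∀ u : X ⟶ Z, ∃ g : Y ⟶ Z, Nonempty (SSet.Homotopy (f ≫ g) u)) ∧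
    (∀ g h : Y ⟶ Z, Nonempty (SSet.Homotopy (f ≫ g) (f ≫ h)) → Nonempty (SSet.Homotopy g h))

/-! ## Categories with three classes of maps -/

/-- Three classes of morphisms in a category. Several such structures on one category have to be
compared, so that this is a structure and not a class. -/
structure Classes (C : Type u) [Category.{v} C] where
  /-- the weak equivalences -/
  weq : MorphismProperty C
  /-- the fibrations -/
  fib : MorphismProperty C
  /-- the cofibrations -/
  cof : MorphismProperty C

/-- The three classes of a model category. -/
def modelClasses (C : Type u) [Category.{v} C] [ModelCategory C] : Classes C where
  weq := weakEquivalences C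
  fib := fibrations C
  cof := cofibrations C

/-- The weak equivalences `W` and the fibrations `F`, together with the class of maps with the
left lifting property with respect to `W ∩ F` as the cofibrations. In a (semi-)model category the
cofibrations are determined by `W` and `F` in this way. -/
def Classes.ofWeqFib {C : Type u} [Category.{v} C] (W F : MorphismProperty C) : Classes C where
  weq := W
  fib := F
  cof := (F ⊓ W).llp

/-- The three classes are the weak equivalences, the fibrations and the cofibrations of a model
category structure on `C`. -/
def Classes.IsModel {C : Type u} [Category.{v} C] (S : Classes C) : Prop :=
  ∃ R : ModelCategory C, @modelClasses C _ R = S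

namespace Classes

variable {C : Type u} [Category.{v} C] (S : Classes C)

/-- Trivial fibrations. -/
def trivFib : MorphismProperty C := S.fib ⊓ S.weq

/-- Trivial cofibrations. -/
def trivCof : MorphismProperty C := S.cof ⊓ S.weq

/-- Cofibrant objects. -/
def IsCofibrant [HasInitial C] (X : C) : Prop := S.cof (initial.to X)

end Classes

/-! ## Simplicial resolutions -/

section Matching

variable {C : Type u} [Category.{v} C]

/-- The category of non-identity injective monotone maps `[m] ⟶ n`. -/
abbrev ProperFace (n : SimplexCategory) : Type :=
  ObjectProperty.FullSubcategory (fun f : Over n => Mono f.hom ∧ ¬ IsIso f.hom)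

/-- The diagram `([m] ⟶ n) ↦ A m` on the opposite of the category of proper faces of `n`, whose
limit is the matching object of the simplicial object `A` at `n`. -/
abbrev matchingDiagram (A : SimplicialObject C) (n : SimplexCategory) :
    (ProperFace n)ᵒᵖ ⥤ C :=
  (ObjectProperty.ι _ ⋙ Over.forget n).op ⋙ A

/-- The cone over the matching diagram with point `A n`. -/
def matchingCone (A : SimplicialObject C) (n : SimplexCategory) :
    Cone (matchingDiagram A n) where
  pt := A.obj (op n)
  π :=
    { app := fun j => A.map (j.unop.obj.hom).op
      naturality := fun i j φ => by
        have h := Over.w φ.unop.hom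
        dsimp
        rw [Category.id_comp, ← A.map_comp, ← op_comp]
        exact congrArg (fun t => A.map (Quiver.Hom.op t)) h.symm }

/-- The matching map of the simplicial object `A` at `n`. -/
noncomputable def matchingMap [HasLimits C] (A : SimplicialObject C) (n : SimplexCategory) :
    A.obj (op n) ⟶ limit (matchingDiagram A n) :=
  limit.lift _ (matchingCone A n)

end Matching

namespace Classes

variable {C : Type u} [Category.{v} C] (S : Classes C)

/-- A simplicial object is Reedy fibrant if all its matching maps are fibrations. -/
def IsReedyFibrant [HasLimits C] (A : SimplicialObject C) : Prop :=
  ∀ n : SimplexCategory, S.fib (matchingMap A n)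

/-- A simplicial resolution of `A`: a levelwise weak equivalence from the constant simplicial
object at `A` to a Reedy fibrant simplicial object. -/
structure IsSimplicialResolution [HasLimits C] {A : C} {R : SimplicialObject C}
    (i : (SimplicialObject.const C).obj A ⟶ R) : Prop where
  weq : ∀ n : SimplexCategoryᵒᵖ, S.weq (i.app n)
  reedyFibrant : S.IsReedyFibrant R

/-- A simplicial resolution of a map `f : A ⟶ B`, up to weak equivalence: a map
`f' : A' ⟶ B'` weakly equivalent to `f`, together with simplicial resolutions of `A'` and of `B'`
and a map `res` of simplicial objects which extends `f'`. In a model category one can always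
take `f' = f`; in a semi-model category `f'` may have to be a cofibrant approximation of `f`,
since simplicial resolutions are only guaranteed to exist for cofibrant objects. -/
structure MapResolution [HasLimits C] {A B : C} (f : A ⟶ B) where
  /-- an object weakly equivalent to `A` -/
  A' : C
  /-- an object weakly equivalent to `B` -/
  B' : C
  /-- a map weakly equivalent to `f` -/
  f' : A' ⟶ B'
  /-- the comparison of the domains -/
  a : A' ⟶ A
  /-- the comparison of the codomains -/
  b : B' ⟶ B
  weq_a : S.weq a
  weq_b : S.weq b
  comm : a ≫ f = f' ≫ b
  /-- the resolution of the domain -/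
  RA : SimplicialObject C
  /-- the resolution of the codomain -/
  RB : SimplicialObject C
  /-- the coaugmentation of `RA` -/
  iA : (SimplicialObject.const C).obj A' ⟶ RA
  /-- the coaugmentation of `RB` -/
  iB : (SimplicialObject.const C).obj B' ⟶ RB
  resolution_iA : S.IsSimplicialResolution iA
  resolution_iB : S.IsSimplicialResolution iB
  /-- the map of resolutions -/
  res : RA ⟶ RB
  comm_res : iA ≫ res = (SimplicialObject.const C).map f' ≫ iB

end Classes

/-- The simplicial set `C(X, A•)`. When `X` is cofibrant and `A•` is a simplicial resolution of
`A`, this is the right homotopy function complex `map(X, A)`. -/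
def homComplex {C : Type u} [Category.{v} C] (X : C) (A : SimplicialObject C) : SSet.{v} :=
  A ⋙ coyoneda.obj (op X)

/-- The map `C(X, A•) ⟶ C(X, B•)` induced by `φ : A• ⟶ B•`. -/
def homComplexMap {C : Type u} [Category.{v} C] (X : C) {A B : SimplicialObject C} (φ : A ⟶ B) :
    homComplex X A ⟶ homComplex X B :=
  Functor.whiskerRight φ (coyoneda.obj (op X))

/-! ## Colocal equivalences, colocal objects, right Bousfield localization -/

namespace Classes

variable {C : Type u} [Category.{v} C] [HasLimits C] (S : Classes C)

/-- For `X` cofibrant, `f` induces a weak equivalence `map(X, A) ⟶ map(X, B)` of right homotopy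
function complexes (computed by any simplicial resolution of `f`). -/
def MapWeq (X : C) {A B : C} (f : A ⟶ B) : Prop :=
  ∀ P : S.MapResolution f, SSetWeakEquivalence (homComplexMap X P.res)

/-- The `K`-colocal equivalences, for a set `K` of cofibrant objects. -/
def colocalEquivalences (K : Set C) : MorphismProperty C :=
  fun _ _ f => ∀ X ∈ K, S.MapWeq X f

/-- The `K`-colocal objects. -/
structure IsColocal [HasInitial C] (K : Set C) (Y : C) : Prop where
  cofibrant : S.IsCofibrant Y
  mapWeq : ∀ ⦃A B : C⦄ (f : A ⟶ B), S.colocalEquivalences K f → S.MapWeq Y f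

/-- The classes of maps of the right Bousfield localization with respect to `K`: the weak
equivalences are the `K`-colocal equivalences, and the fibrations are unchanged. -/
def rightBousfield (K : Set C) : Classes C :=
  Classes.ofWeqFib (S.colocalEquivalences K) S.fib

end Classes

/-! ## Semi-model categories and algebras over a monad -/

/-- The classes `Q` of maps of `D` make `D` a semi-model category over the category `C` with the
classes `S`, along the right adjoint functor `U : D ⥤ C`. -/
structure IsSemiModel {C : Type u} [Category.{v} C] [HasInitial C] {D : Type u'} [Category.{v} D]
    [HasLimits D] [HasColimits D] (S : Classes C) (U : D ⥤ C) [U.IsRightAdjoint]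
    (Q : Classes D) : Prop where
  fib_iff : ∀ ⦃X Y : D⦄ (f : X ⟶ Y), Q.fib f ↔ S.fib (U.map f)
  trivFib_iff : ∀ ⦃X Y : D⦄ (f : X ⟶ Y), Q.trivFib f ↔ S.trivFib (U.map f)
  twoOutOfThree : Q.weq.HasTwoOutOfThreeProperty
  weq_retract : Q.weq.IsStableUnderRetracts
  fib_retract : Q.fib.IsStableUnderRetracts
  cof_retract : Q.cof.IsStableUnderRetracts
  /-- Cofibrations lift against trivial fibrations. -/
  lift_cof : ∀ ⦃A B X Y : D⦄ (i : A ⟶ B) (p : X ⟶ Y), Q.cof i → Q.trivFib p →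
    HasLiftingProperty i p
  /-- Trivial cofibrations with cofibrant domain lift against fibrations. -/
  lift_trivCof : ∀ ⦃A B X Y : D⦄ (i : A ⟶ B) (p : X ⟶ Y), Q.IsCofibrant A → Q.trivCof i →
    Q.fib p → HasLiftingProperty i p
  /-- Functorial factorization of all maps into a cofibration and a trivial fibration. -/
  factor_cof : MorphismProperty.HasFunctorialFactorization Q.cof Q.trivFib
  /-- Functorial factorization of the maps with cofibrant domain into a trivial cofibration and
  a fibration. -/
  factor_trivCof :
    ∃ (Z : ObjectProperty.FullSubcategory (fun f : Arrow D => Q.IsCofibrant f.left) ⥤ D)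
      (i : ObjectProperty.ι _ ⋙ Arrow.leftFunc ⟶ Z)
      (p : Z ⟶ ObjectProperty.ι _ ⋙ Arrow.rightFunc),
      ∀ f, Q.trivCof (i.app f) ∧ Q.fib (p.app f) ∧ i.app f ≫ p.app f = f.obj.hom
  initial_cofibrant : S.IsCofibrant (U.obj (⊥_ D))
  fib_baseChange : Q.fib.IsStableUnderBaseChange
  trivFib_baseChange : Q.trivFib.IsStableUnderBaseChange

section Algebras

variable {M : Type u} [Category.{v} M] (T : Monad M)

instance algebra_hasLimits [HasLimits M] : HasLimits T.Algebra :=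
  hasLimits_of_hasLimits_createsLimits T.forget

/-- The classes of maps on the category of `T`-algebras created by the forgetful functor from
the weak equivalences and the fibrations of `S`. -/
def algClasses (S : Classes M) : Classes T.Algebra :=
  Classes.ofWeqFib (S.weq.inverseImage T.forget) (S.fib.inverseImage T.forget)

/-- The category of `T`-algebras is semi-admissible over `M` with the classes `S`. -/
def IsSemiAdmissible [HasLimits M] [HasInitial M] [HasColimits T.Algebra] (S : Classes M) : Prop :=
  IsSemiModel S T.forget (algClasses T S)

/-- The set `T(K)` of free `T`-algebras on the objects of `K`. -/
def freeSet (K : Set M) : Set T.Algebra := T.free.obj '' K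

/-- The right Bousfield localization of `T`-algebras with respect to `T(K)` exists as a
semi-model category (over the right Bousfield localization of `M` with respect to `K`). -/
def HasFreeRightBousfield [HasLimits M] [HasInitial M] [HasColimits T.Algebra] (S : Classes M)
    (K : Set M) : Prop :=
  IsSemiModel (S.rightBousfield K) T.forget ((algClasses T S).rightBousfield (freeSet T K))

end Algebras

end Colocal

/-!
By Whitehead's theorem, a `K`-colocal equivalence between `K`-colocal objects is a weak equivalence
of `M`, and by Ken Brown's lemma the free functor `T` preserves weak equivalences between cofibrant
objects. Free algebras on `K`-colocal objects are `T(K)`-colocal by the adjunction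
`map(T Z, A) ≃ map(Z, U A)`, as the forgetful functor `U` preserves simplicial resolutions.

Colocality concerns all the resolutions of a map, so that the function complexes have to be
independent of the choice of resolutions. The Reedy factorizations of simplicial objects, obtained
by attaching cells, connect two Reedy fibrant replacements by a zigzag of Reedy trivial fibrations,
and Leibniz tensors show that `C(Z, -)` sends these to trivial fibrations of simplicial sets when
`Z` is cofibrant.
-/

namespace Colocal

open MonoidalCategory CartesianMonoidalCategory Simplicial SSet.modelCategoryQuillen

/-! ## Homotopies and weak equivalences of simplicial sets -/

section Homotopy

/-- Two maps of simplicial sets are homotopic if there is a homotopy from the first one to the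
second one. This is an equivalence relation on maps to a Kan complex. -/
def Homotopic {X Z : SSet.{v}} (f g : X ⟶ Z) : Prop := Nonempty (SSet.Homotopy f g)

lemma whiskerLeft_δ_one_eq_fst_comp_ι₀ (X : SSet.{v}) :
    X ◁ SSet.stdSimplex.δ (1 : Fin 2) = fst X Δ[0] ≫ SSet.ι₀ := by
  ext : 1 <;> simp [SSet.stdSimplex.δ_one_eq_const]

lemma ι₀_comp_whiskerLeft (X : SSet.{v}) {Y : SSet.{v}} (f : Δ[1] ⟶ Y) :
    SSet.ι₀ ≫ X ◁ f =
      lift (𝟙 X) (SSet.const (f.app _ (SSet.stdSimplex.obj₀Equiv.symm 0))) := by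
  simp only [SSet.ι₀, lift_whiskerLeft, SSet.const_comp]

lemma ι₁_comp_whiskerLeft (X : SSet.{v}) {Y : SSet.{v}} (f : Δ[1] ⟶ Y) :
    SSet.ι₁ ≫ X ◁ f =
      lift (𝟙 X) (SSet.const (f.app _ (SSet.stdSimplex.obj₀Equiv.symm 1))) := by
  simp only [SSet.ι₁, lift_whiskerLeft, SSet.const_comp]

lemma ι₀_comp_whiskerLeft_δ_zero (X : SSet.{v}) :
    SSet.ι₀ ≫ X ◁ SSet.stdSimplex.δ (0 : Fin 3) = SSet.ι₁ ≫ X ◁ SSet.stdSimplex.δ 2 := by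
  rw [ι₀_comp_whiskerLeft, ι₁_comp_whiskerLeft]
  congr 2

lemma ι₁_comp_whiskerLeft_δ_zero (X : SSet.{v}) :
    SSet.ι₁ ≫ X ◁ SSet.stdSimplex.δ (0 : Fin 3) = SSet.ι₁ ≫ X ◁ SSet.stdSimplex.δ 1 := by
  rw [ι₁_comp_whiskerLeft, ι₁_comp_whiskerLeft]
  congr 2

namespace Homotopic

variable {X Z W : SSet.{v}} {f g k : X ⟶ Z}

lemma iff_exists : Homotopic f g ↔ ∃ h : X ⊗ Δ[1] ⟶ Z, SSet.ι₀ ≫ h = f ∧ SSet.ι₁ ≫ h = g :=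
  ⟨fun ⟨H⟩ => ⟨H.h, H.h₀, H.h₁⟩, fun ⟨h, h₀, h₁⟩ =>
    ⟨{ h := h, h₀ := h₀, h₁ := h₁, rel := by ext _ ⟨⟨_, hx⟩, _⟩; simp at hx }⟩⟩

lemma refl (f : X ⟶ Z) : Homotopic f f :=
  iff_exists.2 ⟨fst _ _ ≫ f, by simp, by simp⟩

lemma precomp (H : Homotopic f g) (e : W ⟶ X) : Homotopic (e ≫ f) (e ≫ g) := by
  obtain ⟨h, rfl, rfl⟩ := iff_exists.1 H
  exact iff_exists.2 ⟨e ▷ _ ≫ h, by simp, by simp⟩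

lemma postcomp (H : Homotopic f g) (e : Z ⟶ W) : Homotopic (f ≫ e) (g ≫ e) := by
  obtain ⟨h, rfl, rfl⟩ := iff_exists.1 H
  exact iff_exists.2 ⟨h ≫ e, by simp, by simp⟩

lemma euclidean [SSet.KanComplex Z] (hfg : Homotopic f g) (hfk : Homotopic f k) :
    Homotopic g k := by
  obtain ⟨h₁, h₁f, rfl⟩ := iff_exists.1 hfg
  obtain ⟨h₂, h₂f, rfl⟩ := iff_exists.1 hfk
  have sq := SSet.horn₂₀.isPushout.map (tensorLeft X)
  have hδ : X ◁ SSet.stdSimplex.δ (1 : Fin 2) ≫ h₁ = X ◁ SSet.stdSimplex.δ 1 ≫ h₂ := by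
    rw [whiskerLeft_δ_one_eq_fst_comp_ι₀, Category.assoc, Category.assoc, h₁f, h₂f]
  obtain ⟨u, hu₁, hu₂⟩ : ∃ u, X ◁ SSet.horn₂₀.ι₀₁ ≫ u = h₁ ∧ X ◁ SSet.horn₂₀.ι₀₂ ≫ u = h₂ :=
    ⟨sq.desc h₁ h₂ hδ, sq.inl_desc _ _ _, sq.inr_desc _ _ _⟩
  have hlift : HasLiftingProperty (X ◁ Λ[2, 0].ι) (terminal.from Z) :=
    (SSet.anodyneExtensions.horn_ι 0).whiskerLeft X _ ((isFibrant_iff Z).1 ‹_›).1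
  have sq' : CommSq u (X ◁ Λ[2, 0].ι) (terminal.from Z) (terminal.from _) :=
    ⟨terminal.hom_ext _ _⟩
  obtain ⟨H, hH⟩ : ∃ H, X ◁ Λ[2, 0].ι ≫ H = u := ⟨sq'.lift, sq'.fac_left⟩
  have hδ₂ : X ◁ SSet.stdSimplex.δ 2 ≫ H = h₁ := by
    rw [← hu₁, ← hH, ← whiskerLeft_comp_assoc, SSet.horn.ι_ι]
  have hδ₁ : X ◁ SSet.stdSimplex.δ 1 ≫ H = h₂ := by
    rw [← hu₂, ← hH, ← whiskerLeft_comp_assoc, SSet.horn.ι_ι]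
  refine iff_exists.2 ⟨X ◁ SSet.stdSimplex.δ 0 ≫ H, ?_, ?_⟩
  · rw [← hδ₂, ← Category.assoc, ι₀_comp_whiskerLeft_δ_zero, Category.assoc]
  · rw [← hδ₁, ← Category.assoc, ι₁_comp_whiskerLeft_δ_zero, Category.assoc]

lemma symm [SSet.KanComplex Z] (h : Homotopic f g) : Homotopic g f :=
  h.euclidean (refl f)

lemma trans [SSet.KanComplex Z] (h₁ : Homotopic f g) (h₂ : Homotopic g k) : Homotopic f k :=
  h₁.symm.euclidean h₂

end Homotopic

lemma app_surjective_inl_inr {X Y : SSet.{v}} {n : SimplexCategoryᵒᵖ} (x : (X ⨿ Y).obj n) :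
    (∃ a, (coprod.inl : X ⟶ X ⨿ Y).app n a = x) ∨ ∃ b, (coprod.inr : Y ⟶ X ⨿ Y).app n b = x := by
  obtain ⟨⟨_ | _⟩, a, rfl⟩ :=
    FunctorToTypes.jointly_surjective _ n (colimit.isColimit (pair X Y)) x
  · exact Or.inl ⟨a, rfl⟩
  · exact Or.inr ⟨a, rfl⟩

lemma ι₀_app_ne_ι₁_app {X : SSet.{v}} {n : SimplexCategoryᵒᵖ} (a b : X.obj n) :
    SSet.ι₀.app n a ≠ SSet.ι₁.app n b := fun h =>
  absurd (congrArg (fun z => SSet.stdSimplex.asOrderHom z.2 0) h)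
    (by change ¬ (0 : Fin 2) = 1; decide)

lemma mono_coprodDesc_ι₀_ι₁ (X : SSet.{v}) :
    Mono (coprod.desc SSet.ι₀ SSet.ι₁ : X ⨿ X ⟶ X ⊗ Δ[1]) := by
  have hinl (n) (a : X.obj n) : (coprod.desc (SSet.ι₀ (X := X)) SSet.ι₁).app n
      ((coprod.inl (Y := X)).app n a) = SSet.ι₀.app n a :=
    ConcreteCategory.congr_hom (congr_app (coprod.inl_desc SSet.ι₀ SSet.ι₁) n) a
  have hinr (n) (a : X.obj n) : (coprod.desc (SSet.ι₀ (X := X)) SSet.ι₁).app n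
      ((coprod.inr (X := X)).app n a) = SSet.ι₁.app n a :=
    ConcreteCategory.congr_hom (congr_app (coprod.inr_desc SSet.ι₀ SSet.ι₁) n) a
  rw [NatTrans.mono_iff_mono_app]
  intro n
  rw [CategoryTheory.mono_iff_injective]
  intro x y hxy
  obtain ⟨a, rfl⟩ | ⟨a, rfl⟩ := app_surjective_inl_inr x <;>
    obtain ⟨b, rfl⟩ | ⟨b, rfl⟩ := app_surjective_inl_inr y <;>
    simp only [hinl, hinr] at hxy
  · exact congrArg _ (congrArg (·.1) hxy)
  · exact (ι₀_app_ne_ι₁_app _ _ hxy).elim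
  · exact (ι₀_app_ne_ι₁_app _ _ hxy.symm).elim
  · exact congrArg _ (congrArg (·.1) hxy)

namespace SSetWeakEquivalence

variable {X Y W : SSet.{v}} {φ : X ⟶ Y} {ψ : Y ⟶ W}

lemma of_section {s : Y ⟶ X} (hs : s ≫ φ = 𝟙 Y) (h : Homotopic (φ ≫ s) (𝟙 X)) :
    SSetWeakEquivalence φ := by
  refine fun Z _ => ⟨fun u => ⟨s ≫ u, ?_⟩, fun a b H => ?_⟩
  · simpa only [Category.assoc, Category.id_comp] using! h.postcomp u
  · simpa only [reassoc_of% hs] using! Homotopic.precomp H s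

lemma of_rlp (hφ : (MorphismProperty.monomorphisms SSet.{v}).rlp φ) :
    SSetWeakEquivalence φ := by
  have hinit : HasLiftingProperty (initial.to Y) φ :=
    hφ _ (MorphismProperty.monomorphisms.infer_property _)
  have sq : CommSq (initial.to X) (initial.to Y) φ (𝟙 Y) := ⟨by simp⟩
  have hcyl : HasLiftingProperty (coprod.desc SSet.ι₀ SSet.ι₁ : X ⨿ X ⟶ X ⊗ Δ[1]) φ :=
    hφ _ (mono_coprodDesc_ι₀_ι₁ X)
  have sq' : CommSq (coprod.desc (φ ≫ sq.lift) (𝟙 X)) (coprod.desc SSet.ι₀ SSet.ι₁) φ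
      (fst X Δ[1] ≫ φ) := ⟨by ext : 1 <;> simp⟩
  refine of_section sq.fac_right (Homotopic.iff_exists.2 ⟨sq'.lift, ?_, ?_⟩)
  · rw [← coprod.inl_desc_assoc SSet.ι₀ SSet.ι₁, sq'.fac_left, coprod.inl_desc]
  · rw [← coprod.inr_desc_assoc SSet.ι₀ SSet.ι₁, sq'.fac_left, coprod.inr_desc]

lemma of_isIso (φ : X ⟶ Y) [IsIso φ] : SSetWeakEquivalence φ :=
  of_rlp (MorphismProperty.rlp_of_isIso _ _)

lemma comp (hφ : SSetWeakEquivalence φ) (hψ : SSetWeakEquivalence ψ) :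
    SSetWeakEquivalence (φ ≫ ψ) := fun Z hZ => by
  refine ⟨fun u => ?_, fun a b H => ?_⟩
  · obtain ⟨g, hg⟩ := (hφ Z hZ).1 u
    obtain ⟨k, hk⟩ := (hψ Z hZ).1 g
    exact ⟨k, by simpa only [Category.assoc] using! (Homotopic.precomp hk φ).trans hg⟩
  · exact (hψ Z hZ).2 _ _ ((hφ Z hZ).2 _ _ (by simpa only [Category.assoc] using! H))

lemma of_precomp (hφ : SSetWeakEquivalence φ) (hφψ : SSetWeakEquivalence (φ ≫ ψ)) :
    SSetWeakEquivalence ψ := fun Z hZ => by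
  refine ⟨fun u => ?_, fun a b H => ?_⟩
  · obtain ⟨g, hg⟩ := (hφψ Z hZ).1 (φ ≫ u)
    exact ⟨g, (hφ Z hZ).2 _ _ (by simpa only [Category.assoc] using! hg)⟩
  · exact (hφψ Z hZ).2 _ _ (by simpa only [Category.assoc] using! Homotopic.precomp H φ)

lemma of_postcomp (hψ : SSetWeakEquivalence ψ) (hφψ : SSetWeakEquivalence (φ ≫ ψ)) :
    SSetWeakEquivalence φ := fun Z hZ => by
  refine ⟨fun u => ?_, fun a b H => ?_⟩
  · obtain ⟨g, hg⟩ := (hφψ Z hZ).1 u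
    exact ⟨ψ ≫ g, by simpa only [Category.assoc] using! hg⟩
  · obtain ⟨a', ha⟩ := (hψ Z hZ).1 a
    obtain ⟨b', hb⟩ := (hψ Z hZ).1 b
    have hφ : Homotopic (φ ≫ ψ ≫ a') (φ ≫ ψ ≫ b') :=
      (Homotopic.precomp ha φ).trans (Homotopic.trans H (Homotopic.precomp hb φ).symm)
    have hab : Homotopic a' b' :=
      (hφψ Z hZ).2 _ _ (by simpa only [Category.assoc] using! hφ)
    exact (Homotopic.symm ha).trans ((hab.precomp ψ).trans hb)

end SSetWeakEquivalence

/-! ## Connected components -/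

/-- The constant simplicial set with values `S`. Maps into it classify functions on the set of
connected components, and it is a Kan complex. -/
abbrev constSSet (S : Type v) : SSet.{v} := (SimplicialObject.const (Type v)).obj S

section ConstSSet

variable {X Y : SSet.{v}} {S : Type v}

/-- The first vertex of a simplex. -/
def firstVertex {n : SimplexCategoryᵒᵖ} (x : X.obj n) : X _⦋0⦌ :=
  X.map (SimplexCategory.const ⦋0⦌ n.unop 0).op x

lemma firstVertex_of_zero (x : X _⦋0⦌) : firstVertex x = x := by
  rw [firstVertex, Subsingleton.elim (SimplexCategory.const ⦋0⦌ ⦋0⦌ 0) (𝟙 _), op_id,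
    Functor.map_id_apply]

lemma app_firstVertex (φ : X ⟶ Y) {n : SimplexCategoryᵒᵖ} (x : X.obj n) :
    φ.app _ (firstVertex x) = firstVertex (φ.app n x) :=
  ConcreteCategory.congr_hom (φ.naturality _) x

lemma π₀_mk_firstVertex_map {n m : SimplexCategoryᵒᵖ} (θ : n ⟶ m) (x : X.obj n) :
    SSet.π₀.mk (firstVertex (X.map θ x)) = SSet.π₀.mk (firstVertex x) := by
  induction n using Opposite.rec with | _ n
  induction n using SimplexCategory.rec with | _ n
  let e : SimplexCategory.mk 1 ⟶ ⦋n⦌ :=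
    SimplexCategory.mkOfLe 0 (θ.unop.toOrderHom 0) (Fin.zero_le _)
  refine (SSet.π₀.sound (SSet.Edge.mk (X.map e.op x) ?_ ?_)).symm
  · rw [SimplicialObject.δ, ← Functor.map_comp_apply, firstVertex, ← op_comp]
    congr 3
    apply Quiver.Hom.unop_inj
    ext i : 3
    fin_cases i
    rfl
  · rw [SimplicialObject.δ, firstVertex, ← Functor.map_comp_apply, ← Functor.map_comp_apply,
      ← op_comp]
    congr 3
    apply Quiver.Hom.unop_inj
    ext i : 3
    fin_cases i
    rfl

/-- The map to a constant simplicial set given by a function on the connected components. -/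
def toConst (c : SSet.π₀ X → S) : X ⟶ constSSet S where
  app n := ↾fun x => c (.mk (firstVertex x))
  naturality n m θ := by
    ext x
    exact congrArg c (π₀_mk_firstVertex_map θ x)

lemma toConst_app (c : SSet.π₀ X → S) (x : X _⦋0⦌) : (toConst c).app _ x = c (.mk x) :=
  congrArg (fun y => c (.mk y)) (firstVertex_of_zero x)

lemma constSSet_map_app (g : X ⟶ constSSet S) {n m : SimplexCategoryᵒᵖ} (θ : n ⟶ m)
    (x : X.obj n) : g.app m (X.map θ x) = g.app n x :=
  ConcreteCategory.congr_hom (g.naturality θ) x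

lemma constSSet_app_eq_of_π₀_mk_eq (g : X ⟶ constSSet S) {x y : X _⦋0⦌}
    (h : SSet.π₀.mk x = SSet.π₀.mk y) : g.app _ x = g.app _ y := by
  have hg ⦃x y : X _⦋0⦌⦄ (e : X.Edge x y) : g.app _ x = g.app _ y :=
    calc g.app _ x = g.app _ (X.δ 1 e.edge) := by rw [e.src_eq]
      _ = g.app _ (X.δ 0 e.edge) :=
        (constSSet_map_app g (SimplexCategory.δ 1).op e.edge).trans
          (constSSet_map_app g (SimplexCategory.δ 0).op e.edge).symm
      _ = g.app _ y := by rw [e.tgt_eq]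
  exact congrArg (SSet.π₀.lift (fun x => g.app _ x) hg) h

lemma constSSet_app_stdSimplex {n : ℕ} (g : Δ[n] ⟶ constSSet S) {m : SimplexCategoryᵒᵖ}
    (x : (Δ[n] : SSet.{v}).obj m) : g.app m x = SSet.yonedaEquiv g := by
  obtain ⟨s, rfl⟩ := SSet.yonedaEquiv.symm.surjective g
  exact (SSet.yonedaEquiv.apply_symm_apply s).symm

lemma yonedaEquiv_eq_of_isCompatible {n : ℕ} {i : Fin (n + 2)}
    {f : ∀ j : Fin (n + 2), j ≠ i → ((Δ[n] : SSet.{v}) ⟶ constSSet S)}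
    (hf : SSet.horn.IsCompatible f) {j k : Fin (n + 2)} (hj : j ≠ i) (hk : k ≠ i) :
    SSet.yonedaEquiv (f j hj) = SSet.yonedaEquiv (f k hk) := by
  wlog hjk : j < k generalizing j k
  · obtain rfl | hkj := (not_lt.1 hjk).eq_or_lt
    · rfl
    · exact (this hk hj hkj).symm
  obtain _ | n := n
  · omega
  · have h := ConcreteCategory.congr_hom (congr_app (hf j k hj hk hjk) (op ⦋0⦌))
      (SSet.stdSimplex.obj₀Equiv.symm 0)
    exact (constSSet_app_stdSimplex (f j hj) (m := op ⦋0⦌) _).symm.trans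
      (h.trans (constSSet_app_stdSimplex (f k hk) (m := op ⦋0⦌) _))

instance kanComplex_constSSet (S : Type v) : SSet.KanComplex (constSSet S) := by
  rw [SSet.KanComplex.iff]
  intro n i f hf
  obtain ⟨j, hj⟩ := exists_ne i
  let s : S := SSet.yonedaEquiv (f j hj)
  refine ⟨{ app _ := ↾fun _ => s }, fun k hk => ?_⟩
  ext m x
  exact (yonedaEquiv_eq_of_isCompatible hf hj hk).trans (constSSet_app_stdSimplex _ x).symm

lemma Homotopic.app_eq {f g : X ⟶ constSSet S} (H : Homotopic f g) (x : X _⦋0⦌) :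
    f.app _ x = g.app _ x := by
  obtain ⟨h, rfl, rfl⟩ := Homotopic.iff_exists.1 H
  refine constSSet_app_eq_of_π₀_mk_eq h (SSet.π₀.sound (SSet.Edge.mk
    (show (X ⊗ Δ[1]) _⦋1⦌ from ⟨X.σ 0 x, SSet.stdSimplex.objEquiv.symm (𝟙 _)⟩) ?_ ?_))
  · refine Prod.ext (SSet.Edge.id x).src_eq (SSet.stdSimplex.ext _ _ fun i => ?_)
    fin_cases i
    rfl
  · refine Prod.ext (SSet.Edge.id x).tgt_eq (SSet.stdSimplex.ext _ _ fun i => ?_)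
    fin_cases i
    rfl

end ConstSSet

namespace SSetWeakEquivalence

variable {X Y : SSet.{v}} {φ : X ⟶ Y}

lemma mapπ₀_surjective (hφ : SSetWeakEquivalence φ) : Function.Surjective (SSet.mapπ₀ φ) := by
  let c (y : SSet.π₀ Y) : ULift.{v} Prop := ⟨∃ x, SSet.mapπ₀ φ x = y⟩
  have h : φ ≫ toConst c = φ ≫ toConst fun _ => ⟨True⟩ := by
    ext n x
    refine congrArg ULift.up (eq_true ⟨.mk (firstVertex x), ?_⟩)
    rw [SSet.mapπ₀_mk, app_firstVertex]
    rfl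
  intro y
  induction y with | _ y
  have H₀ : Homotopic (φ ≫ toConst c) (φ ≫ toConst fun _ => ⟨True⟩) := by
    rw [h]
    exact Homotopic.refl _
  have H := Homotopic.app_eq ((hφ _ inferInstance).2 _ _ H₀) y
  rw [toConst_app, toConst_app] at H
  exact of_eq_true (congrArg ULift.down H)

lemma mapπ₀_injective (hφ : SSetWeakEquivalence φ) : Function.Injective (SSet.mapπ₀ φ) := by
  obtain ⟨g, hg⟩ := (hφ (constSSet (SSet.π₀ X)) inferInstance).1 (toConst id)
  intro x y hxy
  induction x with | _ x
  induction y with | _ y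
  calc SSet.π₀.mk x = (φ ≫ g).app _ x := by rw [Homotopic.app_eq hg, toConst_app, id]
    _ = (φ ≫ g).app _ y := constSSet_app_eq_of_π₀_mk_eq g hxy
    _ = SSet.π₀.mk y := by rw [Homotopic.app_eq hg, toConst_app, id]

end SSetWeakEquivalence

end Homotopy

/-! ## Boundaries of simplices and matching objects -/

section Boundary

variable {n : ℕ} {Q : SSet.{v}}

/-- A proper face of `[n]`, as a simplex of the boundary `∂Δ[n]`. -/
def faceSimplex (m : ProperFace ⦋n⦌) : (∂Δ[n] : SSet.{v}).obj (op m.obj.left) :=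
  ⟨SSet.stdSimplex.objEquiv.symm m.obj.hom, fun h => m.property.2 (by
    have : Mono m.obj.hom := m.property.1
    have : Epi m.obj.hom := SimplexCategory.epi_iff_surjective.2 h
    exact isIso_of_mono_of_epi _)⟩

lemma boundary_map_faceSimplex {m m' : ProperFace ⦋n⦌} (φ : m ⟶ m') :
    (∂Δ[n] : SSet.{v}).map φ.hom.left.op (faceSimplex m') = faceSimplex m :=
  Subtype.ext (congrArg SSet.stdSimplex.objEquiv.symm (Over.w φ.hom))

lemma exists_map_faceSimplex_eq {k : SimplexCategoryᵒᵖ} (x : (∂Δ[n] : SSet.{v}).obj k) :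
    ∃ (m : ProperFace ⦋n⦌) (e : k.unop ⟶ m.obj.left), Epi e ∧
      (∂Δ[n] : SSet.{v}).map e.op (faceSimplex m) = x := by
  let θ := SSet.stdSimplex.objEquiv x.1
  have hθ : ¬ IsIso (image.ι θ) := fun h => x.2 <| by
    have : Epi (factorThruImage θ ≫ image.ι θ) := inferInstance
    rw [image.fac] at this
    exact SimplexCategory.epi_iff_surjective.1 this
  exact ⟨⟨Over.mk (image.ι θ), inferInstanceAs (Mono (image.ι θ)), hθ⟩, factorThruImage θ,
    inferInstance, Subtype.ext (congrArg SSet.stdSimplex.objEquiv.symm (image.fac θ))⟩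

lemma exists_hom_of_map_faceSimplex_eq {k : SimplexCategoryᵒᵖ} {m m' : ProperFace ⦋n⦌}
    (e : k.unop ⟶ m.obj.left) [Epi e] (e' : k.unop ⟶ m'.obj.left)
    (h : (∂Δ[n] : SSet.{v}).map e.op (faceSimplex m) =
      (∂Δ[n] : SSet.{v}).map e'.op (faceSimplex m')) :
    ∃ φ : m ⟶ m', e ≫ φ.hom.left = e' := by
  have : Mono m'.obj.hom := m'.property.1
  have : StrongEpi e := strongEpi_of_epi e
  have sq : CommSq e' e m'.obj.hom m.obj.hom :=
    ⟨(SSet.stdSimplex.objEquiv.symm.injective (congrArg Subtype.val h)).symm⟩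
  exact ⟨ObjectProperty.homMk (Over.homMk sq.lift sq.fac_right), sq.fac_left⟩

lemma boundary_hom_ext {f g : (∂Δ[n] : SSet.{v}) ⟶ Q}
    (h : ∀ m, f.app _ (faceSimplex m) = g.app _ (faceSimplex m)) : f = g := by
  ext k x
  obtain ⟨m, e, -, rfl⟩ := exists_map_faceSimplex_eq x
  calc f.app _ ((∂Δ[n] : SSet.{v}).map e.op (faceSimplex m))
      = Q.map e.op (f.app _ (faceSimplex m)) := ConcreteCategory.congr_hom (f.naturality e.op) _
    _ = Q.map e.op (g.app _ (faceSimplex m)) := by rw [h]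
    _ = _ := (ConcreteCategory.congr_hom (g.naturality e.op) _).symm

lemma exists_boundary_hom (z : ∀ m : ProperFace ⦋n⦌, Q.obj (op m.obj.left))
    (hz : ∀ ⦃m m' : ProperFace ⦋n⦌⦄ (φ : m ⟶ m'), Q.map φ.hom.left.op (z m') = z m) :
    ∃ f : (∂Δ[n] : SSet.{v}) ⟶ Q, ∀ m, f.app _ (faceSimplex m) = z m := by
  choose m e he hx using fun (k : SimplexCategoryᵒᵖ) (x : (∂Δ[n] : SSet.{v}).obj k) =>
    exists_map_faceSimplex_eq x
  have map_eq {k : SimplexCategoryᵒᵖ} {x : (∂Δ[n] : SSet.{v}).obj k} {m' : ProperFace ⦋n⦌}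
      {e' : k.unop ⟶ m'.obj.left} (h : (∂Δ[n] : SSet.{v}).map e'.op (faceSimplex m') = x) :
      Q.map (e k x).op (z (m k x)) = Q.map e'.op (z m') := by
    have := he k x
    obtain ⟨φ, hφ⟩ := exists_hom_of_map_faceSimplex_eq (e k x) e' ((hx k x).trans h.symm)
    rw [← hz φ, ← Functor.map_comp_apply, ← op_comp, hφ]
  refine ⟨{ app k := ↾fun x => Q.map (e k x).op (z (m k x)), naturality := fun k k' θ => ?_ },
    fun m' => ?_⟩
  · ext x
    have h : (∂Δ[n] : SSet.{v}).map (θ.unop ≫ e k x).op (faceSimplex (m k x)) =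
        (∂Δ[n] : SSet.{v}).map θ x := by
      conv_rhs => rw [← hx k x]
      rw [op_comp, Functor.map_comp_apply, Quiver.Hom.op_unop]
    exact (map_eq h).trans (ConcreteCategory.congr_hom (Q.map_comp (e k x).op θ) _)
  · have h : (∂Δ[n] : SSet.{v}).map (𝟙 m'.obj.left).op (faceSimplex m') = faceSimplex m' :=
      ConcreteCategory.congr_hom ((∂Δ[n] : SSet.{v}).map_id _) _
    calc Q.map (e _ (faceSimplex m')).op (z (m _ (faceSimplex m')))
        = Q.map (𝟙 m'.obj.left).op (z m') := map_eq h
      _ = z m' := ConcreteCategory.congr_hom (Q.map_id _) _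

end Boundary

section Matching

variable {C : Type u} [Category.{v} C] {X Y : C} {R R' R'' : SimplicialObject C}

/-- The map `C(Y, R•) ⟶ C(X, R•)` induced by a map `X ⟶ Y`. -/
def homComplexPrecomp (i : X ⟶ Y) (R : SimplicialObject C) : homComplex Y R ⟶ homComplex X R :=
  Functor.whiskerLeft R (coyoneda.map i.op)

/-- The Yoneda bijection for the simplices of `C(X, R•)`. -/
def simplexHomEquiv (X : C) (R : SimplicialObject C) (n : ℕ) :
    (Δ[n] ⟶ homComplex X R) ≃ (X ⟶ R _⦋n⦌) :=
  SSet.yonedaEquiv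

lemma simplexHomEquiv_precomp (i : X ⟶ Y) {n : ℕ} (f : Δ[n] ⟶ homComplex Y R) :
    simplexHomEquiv X R n (f ≫ homComplexPrecomp i R) = i ≫ simplexHomEquiv Y R n f :=
  rfl

lemma simplexHomEquiv_map (ψ : R ⟶ R') {n : ℕ} (f : Δ[n] ⟶ homComplex X R) :
    simplexHomEquiv X R' n (f ≫ homComplexMap X ψ) = simplexHomEquiv X R n f ≫ ψ.app _ :=
  rfl

variable [HasLimits C]

/-- The map of matching objects induced by a map of simplicial objects. -/
noncomputable def matchingObjMap (ψ : R ⟶ R') (n : SimplexCategory) :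
    limit (matchingDiagram R n) ⟶ limit (matchingDiagram R' n) :=
  limMap (Functor.whiskerLeft _ ψ)

@[simp]
lemma matchingObjMap_π (ψ : R ⟶ R') (n : SimplexCategory) (m : (ProperFace n)ᵒᵖ) :
    matchingObjMap ψ n ≫ limit.π (matchingDiagram R' n) m =
      limit.π (matchingDiagram R n) m ≫ ψ.app (op m.unop.obj.left) :=
  limMap_π _ _

lemma matchingObjMap_comp (ψ : R ⟶ R') (ψ' : R' ⟶ R'') (n : SimplexCategory) :
    matchingObjMap (ψ ≫ ψ') n = matchingObjMap ψ n ≫ matchingObjMap ψ' n :=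
  lim.map_comp (Functor.whiskerLeft _ ψ) (Functor.whiskerLeft _ ψ')

@[simp]
lemma matchingMap_π (R : SimplicialObject C) (n : SimplexCategory) (m : (ProperFace n)ᵒᵖ) :
    matchingMap R n ≫ limit.π (matchingDiagram R n) m = R.map m.unop.obj.hom.op :=
  limit.lift_π _ _

lemma matchingMap_naturality (ψ : R ⟶ R') (n : SimplexCategory) :
    matchingMap R n ≫ matchingObjMap ψ n = ψ.app (op n) ≫ matchingMap R' n :=
  limit.hom_ext fun m => by
    rw [Category.assoc, matchingObjMap_π, Category.assoc, matchingMap_π]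
    exact (Category.assoc _ _ _).symm.trans
      ((congrArg (· ≫ ψ.app _) (matchingMap_π R n m)).trans (ψ.naturality _))

/-- The map to the matching object given by the values of a map from the boundary on the proper
faces. -/
noncomputable def ofBoundary {n : ℕ} (f : (∂Δ[n] : SSet.{v}) ⟶ homComplex X R) :
    X ⟶ limit (matchingDiagram R ⦋n⦌) :=
  limit.lift (matchingDiagram R ⦋n⦌)
    { pt := X
      π :=
        { app m := f.app _ (faceSimplex m.unop)
          naturality m m' φ := by
            have h := ConcreteCategory.congr_hom (f.naturality φ.unop.hom.left.op)
              (faceSimplex m.unop)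
            rw [ConcreteCategory.comp_apply, boundary_map_faceSimplex.{v} φ.unop] at h
            exact (Category.id_comp _).trans h } }

lemma ofBoundary_π {n : ℕ} (f : (∂Δ[n] : SSet.{v}) ⟶ homComplex X R) (m : (ProperFace ⦋n⦌)ᵒᵖ) :
    ofBoundary f ≫ limit.π (matchingDiagram R ⦋n⦌) m = f.app _ (faceSimplex m.unop) :=
  limit.lift_π _ _

lemma ofBoundary_bijective (X : C) (R : SimplicialObject C) (n : ℕ) :
    Function.Bijective (ofBoundary (X := X) (R := R) (n := n)) := by
  refine ⟨fun f g h => boundary_hom_ext fun m => ?_, fun x => ?_⟩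
  · exact (ofBoundary_π f (op m)).symm.trans ((congrArg (· ≫ _) h).trans (ofBoundary_π g (op m)))
  · obtain ⟨f, hf⟩ := exists_boundary_hom (Q := homComplex X R)
      (fun m => x ≫ limit.π (matchingDiagram R ⦋n⦌) (op m)) fun m m' φ =>
        (Category.assoc _ _ _).trans (congrArg (x ≫ ·) (limit.w (matchingDiagram R ⦋n⦌) φ.op))
    exact ⟨f, limit.hom_ext fun m => (ofBoundary_π f m).trans (hf m.unop)⟩

/-- Maps from `∂Δ[n]` to `C(X, R•)` correspond to maps from `X` to the matching object of `R` at
`n`. -/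
noncomputable def boundaryHomEquiv (X : C) (R : SimplicialObject C) (n : ℕ) :
    ((∂Δ[n] : SSet.{v}) ⟶ homComplex X R) ≃ (X ⟶ limit (matchingDiagram R ⦋n⦌)) :=
  .ofBijective ofBoundary (ofBoundary_bijective X R n)

lemma boundaryHomEquiv_precomp (i : X ⟶ Y) {n : ℕ} (f : (∂Δ[n] : SSet.{v}) ⟶ homComplex Y R) :
    boundaryHomEquiv X R n (f ≫ homComplexPrecomp i R) = i ≫ boundaryHomEquiv Y R n f :=
  limit.hom_ext fun m => (ofBoundary_π _ m).trans <| by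
    rw [Category.assoc]
    exact (congrArg (i ≫ ·) (ofBoundary_π f m)).symm

lemma boundaryHomEquiv_map (ψ : R ⟶ R') {n : ℕ} (f : (∂Δ[n] : SSet.{v}) ⟶ homComplex X R) :
    boundaryHomEquiv X R' n (f ≫ homComplexMap X ψ) =
      boundaryHomEquiv X R n f ≫ matchingObjMap ψ ⦋n⦌ :=
  limit.hom_ext fun m => (ofBoundary_π _ m).trans <| by
    rw [Category.assoc, matchingObjMap_π]
    exact (congrArg (· ≫ ψ.app _) (ofBoundary_π f m)).symm.trans (Category.assoc _ _ _)

lemma boundaryHomEquiv_boundary_ι {n : ℕ} (f : Δ[n] ⟶ homComplex X R) :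
    boundaryHomEquiv X R n (∂Δ[n].ι ≫ f) = simplexHomEquiv X R n f ≫ matchingMap R ⦋n⦌ := by
  obtain ⟨x, rfl⟩ := (simplexHomEquiv X R n).symm.surjective f
  refine limit.hom_ext fun m => (ofBoundary_π _ m).trans ?_
  rw [Equiv.apply_symm_apply, Category.assoc, matchingMap_π]
  rfl

end Matching

/-! ## Leibniz tensors and Reedy fibrations -/

lemma hasLiftingProperty_pullback_iff {C : Type u} [Category.{v} C] {A B E P X Y Z : C} (j : A ⟶ B)
    {e : E ⟶ X} {f : E ⟶ Y} {g : X ⟶ Z} {h : Y ⟶ Z} {p : P ⟶ X} {q : P ⟶ Y}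
    (sq : IsPullback p q g h) {π : E ⟶ P} (hp : π ≫ p = e) (hq : π ≫ q = f) :
    HasLiftingProperty j π ↔ ∀ (t : A ⟶ E) (x : B ⟶ X) (y : B ⟶ Y), t ≫ e = j ≫ x →
      t ≫ f = j ≫ y → x ≫ g = y ≫ h → ∃ l : B ⟶ E, j ≫ l = t ∧ l ≫ e = x ∧ l ≫ f = y := by
  subst hp hq
  refine ⟨fun H t x y hx hy hxy => ?_, fun H => ⟨fun {t b} s => ?_⟩⟩
  · have s : CommSq t j π (sq.lift x y hxy) := ⟨by apply sq.hom_ext <;> simpa⟩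
    refine ⟨s.lift, s.fac_left, ?_, ?_⟩
    · rw [s.fac_right_assoc, sq.lift_fst]
    · rw [s.fac_right_assoc, sq.lift_snd]
  · obtain ⟨l, hl, hx, hy⟩ := H t (b ≫ p) (b ≫ q) (by simp [s.w_assoc]) (by simp [s.w_assoc])
      (by simp [sq.w])
    exact ⟨⟨{ l := l, fac_left := hl, fac_right := sq.hom_ext (by simpa) (by simpa) }⟩⟩

section Tensor

variable (C : Type u) [Category.{v} C]

/-- The bifunctor `(X, R•) ↦ C(X, R•)`. -/
abbrev homBifunctor : Cᵒᵖ ⥤ SimplicialObject C ⥤ SSet.{v} :=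
  coyoneda ⋙ Functor.whiskeringRight SimplexCategoryᵒᵖ C (Type v)

instance (R : SimplicialObject C) :
    PreservesLimitsOfShape (Discrete PEmpty.{1}) ((homBifunctor C).flip.obj R) :=
  preservesLimitsOfShape_of_evaluation _ _ fun n =>
    inferInstanceAs (PreservesLimitsOfShape _ (yoneda.obj (R.obj n)))

variable [HasColimits C]

/-- The tensor of an object of `C` with a simplicial set, given by copowers in each degree. -/
noncomputable abbrev tensor : C ⥤ SSet.{v} ⥤ SimplicialObject C :=
  sigmaConst.{v} ⋙ Functor.whiskeringRight SimplexCategoryᵒᵖ (Type v) C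

/-- Copowers are left adjoint to representable functors, as bifunctors. -/
noncomputable def copowerAdj : (sigmaConst.{v} : C ⥤ Type v ⥤ C) ⊣₂ coyoneda where
  adj X := sigmaConstAdj X
  unit_whiskerRight_map {X Y} f := by
    ext S s
    exact Sigma.ι_map (fun _ : S => f) s

/-- Tensors are left adjoint to the functors `C(X, -)`, as bifunctors. -/
noncomputable def tensorAdj : tensor C ⊣₂ homBifunctor C where
  adj X := (sigmaConstAdj X).whiskerRight _
  unit_whiskerRight_map {X Y} f := by
    ext A n s
    have := NatTrans.congr_app ((copowerAdj C).unit_whiskerRight_map f) (A.obj n)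
    exact ConcreteCategory.congr_hom this s

end Tensor

section Leibniz

variable {C : Type u} [Category.{v} C] {X Y : C} (i : X ⟶ Y) {R R' : SimplicialObject C}
  (ψ : R ⟶ R') {A B : SSet.{v}} (j : A ⟶ B)

/-- The map `C(Y, R) ⟶ C(X, R) ×_{C(X, R')} C(Y, R')` of simplicial sets. -/
noncomputable def leibnizHom : (homBifunctor C).PullbackObjObj i ψ :=
  .ofHasPullback _ i ψ

lemma hasLiftingProperty_leibnizHom_iff :
    HasLiftingProperty j (leibnizHom i ψ).π ↔ ∀ (t : A ⟶ homComplex Y R) (x : B ⟶ homComplex X R)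
      (y : B ⟶ homComplex Y R'), t ≫ homComplexPrecomp i R = j ≫ x →
      t ≫ homComplexMap Y ψ = j ≫ y → x ≫ homComplexMap X ψ = y ≫ homComplexPrecomp i R' →
      ∃ l : B ⟶ homComplex Y R, j ≫ l = t ∧ l ≫ homComplexPrecomp i R = x ∧
        l ≫ homComplexMap Y ψ = y :=
  hasLiftingProperty_pullback_iff j (leibnizHom i ψ).isPullback (leibnizHom i ψ).π_fst
    (leibnizHom i ψ).π_snd

variable [HasColimits C]

/-- The map `X ⊗ B ∪ Y ⊗ A ⟶ Y ⊗ B` of simplicial objects. -/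
noncomputable def leibnizTensor : (tensor C).PushoutObjObj i j :=
  .ofHasPushout _ i j

lemma hasLiftingProperty_leibnizTensor_iff :
    HasLiftingProperty (leibnizTensor i j).ι ψ ↔ HasLiftingProperty j (leibnizHom i ψ).π :=
  (tensorAdj C).hasLiftingProperty_iff _ _

/-- The Leibniz tensors of the maps in `L` with the monomorphisms of simplicial sets. -/
inductive leibnizTensors (L : MorphismProperty C) : MorphismProperty (SimplicialObject C) where
  | mk {X Y : C} (i : X ⟶ Y) {A B : SSet.{v}} (j : A ⟶ B) (hi : L i) (hj : Mono j) :
    leibnizTensors L (leibnizTensor i j).ι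

variable {ψ} in
lemma rlp_homComplexMap_of_rlp_leibnizTensors {L : MorphismProperty C} {Z : C}
    (hZ : L (initial.to Z)) (hψ : (leibnizTensors L).rlp ψ) :
    (MorphismProperty.monomorphisms SSet.{v}).rlp (homComplexMap Z ψ) := fun _ _ j hj =>
  ((tensorAdj C).hasLiftingProperty_iff (leibnizTensor (initial.to Z) j)
    (Functor.PullbackObjObj.ofIsInitial (homBifunctor C) (initial.to Z) ψ initialIsInitial)).1
    (hψ _ ⟨_, j, hZ, hj⟩)

lemma rlp_leibnizTensors_iff (L : MorphismProperty C) :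
    (leibnizTensors L).rlp ψ ↔ ∀ ⦃X Y : C⦄ (i : X ⟶ Y), L i → ∀ n : ℕ,
      HasLiftingProperty ∂Δ[n].ι (leibnizHom i ψ).π := by
  refine ⟨fun h X Y i hi n => (hasLiftingProperty_leibnizTensor_iff _ _ _).1
    (h _ ⟨i, _, hi, inferInstance⟩), ?_⟩
  rintro h _ _ _ ⟨i, j, hi, hj⟩
  have hπ : (MorphismProperty.monomorphisms SSet.{v}).rlp (leibnizHom i ψ).π := by
    rw [SSet.rlp_monomorphisms]
    rintro _ _ _ ⟨n⟩
    exact h i hi n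
  exact (hasLiftingProperty_leibnizTensor_iff i ψ j).2 (hπ _ hj)

end Leibniz

section Reedy

variable {C : Type u} [Category.{v} C] {X Y : C} (i : X ⟶ Y) {R R' : SimplicialObject C}
  (ψ : R ⟶ R') [HasLimits C]

/-- The relative matching map `R_n ⟶ M_n R ×_{M_n R'} R'_n`. -/
noncomputable def relMatchingMap (n : SimplexCategory) :
    R.obj (op n) ⟶ pullback (matchingObjMap ψ n) (matchingMap R' n) :=
  pullback.lift (matchingMap R n) (ψ.app (op n)) (matchingMap_naturality ψ n)

@[simp]
lemma relMatchingMap_fst (n : SimplexCategory) :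
    relMatchingMap ψ n ≫ pullback.fst _ _ = matchingMap R n :=
  pullback.lift_fst _ _ _

@[simp]
lemma relMatchingMap_snd (n : SimplexCategory) :
    relMatchingMap ψ n ≫ pullback.snd _ _ = ψ.app (op n) :=
  pullback.lift_snd _ _ _

/-- The maps of simplicial objects whose relative matching maps are all in `F`. -/
def reedyFibrations (F : MorphismProperty C) : MorphismProperty (SimplicialObject C) :=
  fun _ _ ψ => ∀ n, F (relMatchingMap ψ n)

lemma hasLiftingProperty_relMatchingMap_iff (n : ℕ) :
    HasLiftingProperty i (relMatchingMap ψ ⦋n⦌) ↔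
      HasLiftingProperty ∂Δ[n].ι (leibnizHom i ψ).π := by
  rw [hasLiftingProperty_leibnizHom_iff, hasLiftingProperty_pullback_iff i
    (IsPullback.of_hasPullback _ _) (relMatchingMap_fst ψ ⦋n⦌) (relMatchingMap_snd ψ ⦋n⦌)]
  constructor
  · intro h t x y hx hy hxy
    obtain ⟨l, hlx, hlt, hly⟩ := h (simplexHomEquiv _ _ _ x) (boundaryHomEquiv _ _ _ t)
      (simplexHomEquiv _ _ _ y)
      (by rw [← boundaryHomEquiv_boundary_ι, ← hx, boundaryHomEquiv_precomp])
      (by rw [← simplexHomEquiv_map, hxy, simplexHomEquiv_precomp])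
      (by rw [← boundaryHomEquiv_map, hy, boundaryHomEquiv_boundary_ι])
    obtain ⟨l, rfl⟩ := (simplexHomEquiv _ _ _).surjective l
    refine ⟨l, (boundaryHomEquiv _ _ _).injective ?_, (simplexHomEquiv _ _ _).injective hlx,
      (simplexHomEquiv _ _ _).injective hly⟩
    rw [boundaryHomEquiv_boundary_ι, hlt]
  · intro h x t y hx hy hty
    obtain ⟨x, rfl⟩ := (simplexHomEquiv _ _ n).surjective x
    obtain ⟨t, rfl⟩ := (boundaryHomEquiv _ _ _).surjective t
    obtain ⟨y, rfl⟩ := (simplexHomEquiv _ _ n).surjective y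
    rw [← boundaryHomEquiv_boundary_ι, ← boundaryHomEquiv_precomp] at hx
    rw [← boundaryHomEquiv_map, ← boundaryHomEquiv_boundary_ι] at hty
    obtain ⟨l, rfl, rfl, rfl⟩ := h t x y ((boundaryHomEquiv _ _ _).injective hx.symm)
      ((boundaryHomEquiv _ _ _).injective hty) ((simplexHomEquiv _ _ _).injective hy)
    exact ⟨simplexHomEquiv _ _ _ l, rfl, (boundaryHomEquiv_boundary_ι l).symm, rfl⟩

lemma rlp_leibnizTensors [HasColimits C] (L : MorphismProperty C) :
    (leibnizTensors L).rlp = reedyFibrations L.rlp := by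
  ext R R' ψ
  simp only [rlp_leibnizTensors_iff, ← hasLiftingProperty_relMatchingMap_iff]
  refine ⟨fun h n => ?_, fun h _ _ i hi n => h _ i hi⟩
  induction n using SimplexCategory.rec with | _ n
  exact fun _ _ i hi => h i hi n

variable {ψ} in
lemma reedyFibrations_iff_of_isTerminal (F : MorphismProperty C) [F.RespectsIso]
    (hR' : IsTerminal R') :
    reedyFibrations F ψ ↔ ∀ n, F (matchingMap R n) := by
  refine forall_congr' fun n => ?_
  have isTerminal_obj (k) : IsTerminal (R'.obj k) := hR'.isTerminalObj ((evaluation _ _).obj k)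
  have : IsIso (matchingMap R' n) :=
    ⟨(isTerminal_obj _).from _, (isTerminal_obj _).hom_ext _ _,
      limit.hom_ext fun m => (isTerminal_obj _).hom_ext _ _⟩
  rw [← relMatchingMap_fst ψ, F.cancel_right_of_respectsIso]

end Reedy

/-! ## Reedy trivial fibrations -/

lemma hasLiftingProperty_initial_to_of_boundaries {A : SSet.{v}} {n : ℕ} [A.HasDimensionLT n]
    {E B : SSet.{v}} (p : E ⟶ B) (hp : ∀ k < n, HasLiftingProperty ∂Δ[k].ι p) :
    HasLiftingProperty (initial.to A) p := by
  have : Mono (initial.to A) := MorphismProperty.monomorphisms.infer_property _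
  let I : MorphismProperty SSet.{v} := .ofHoms fun k : Fin n => ∂Δ[k.1].ι
  have hI : I.rlp p := by
    rintro _ _ _ ⟨k⟩
    exact hp k.1 k.2
  exact MorphismProperty.transfiniteCompositionsOfShape_pushouts_coproducts_le_llp_rlp.{v} I ℕ _
    ⟨(SSet.relativeCellComplexOfMono (initial.to A)).transfiniteCompositionOfShape' fun c =>
      .mk (⟨c.j, A.dim_lt_of_nonDegenerate ⟨_, c.k.nonDegenerate⟩ n⟩ : Fin n)⟩ _ hI

section ReedyTrivial

variable {C : Type u} [Category.{v} C] [HasLimits C] {R R' : SimplicialObject C} {ψ : R ⟶ R'}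

lemma hasLiftingProperty_matchingObjMap {X Y : C} (i : X ⟶ Y) (n : ℕ)
    (h : ∀ k < n, HasLiftingProperty i (relMatchingMap ψ ⦋k⦌)) :
    HasLiftingProperty i (matchingObjMap ψ ⦋n⦌) := by
  have lift_boundary := hasLiftingProperty_initial_to_of_boundaries (A := (∂Δ[n] : SSet.{v}))
    (n := n) (leibnizHom i ψ).π fun k hk => (hasLiftingProperty_relMatchingMap_iff i ψ k).1 (h k hk)
  rw [hasLiftingProperty_leibnizHom_iff] at lift_boundary
  refine ⟨fun {x y} s => ?_⟩
  obtain ⟨x, rfl⟩ := (boundaryHomEquiv _ _ _).surjective x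
  obtain ⟨y, rfl⟩ := (boundaryHomEquiv _ _ _).surjective y
  have hxy : x ≫ homComplexMap X ψ = y ≫ homComplexPrecomp i R' :=
    (boundaryHomEquiv _ _ _).injective (by
      rw [boundaryHomEquiv_map, boundaryHomEquiv_precomp, s.w])
  obtain ⟨l, -, rfl, rfl⟩ := lift_boundary (initial.to _) x y (initialIsInitial.hom_ext _ _)
    (initialIsInitial.hom_ext _ _) hxy
  exact ⟨⟨{
    l := boundaryHomEquiv _ _ _ l
    fac_left := (boundaryHomEquiv_precomp _ _).symm
    fac_right := (boundaryHomEquiv_map _ _).symm }⟩⟩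

lemma rlp_matchingObjMap {L : MorphismProperty C} {n : ℕ}
    (h : ∀ k < n, L.rlp (relMatchingMap ψ ⦋k⦌)) : L.rlp (matchingObjMap ψ ⦋n⦌) :=
  fun _ _ i hi => hasLiftingProperty_matchingObjMap i n fun k hk => h k hk i hi

end ReedyTrivial

section ReedyTrivialModel

variable {M : Type u} [Category.{v} M] [ModelCategory M] [HasLimits M]
  {R R' : SimplicialObject M} {ψ : R ⟶ R'}

lemma reedyFibrations_trivialFibrations (h : reedyFibrations (fibrations M) ψ)
    (hw : (weakEquivalences M).functorCategory _ ψ) :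
    reedyFibrations (trivialFibrations M) ψ := fun n => by
  induction n using SimplexCategory.rec with | _ n
  induction n using Nat.strong_induction_on with | _ n ih
  rw [← MorphismProperty.rlp_eq_of_wfs (cofibrations M) (trivialFibrations M)] at ih
  have hsnd : trivialFibrations M (pullback.snd (matchingObjMap ψ ⦋n⦌) (matchingMap R' ⦋n⦌)) := by
    rw [← MorphismProperty.rlp_eq_of_wfs (cofibrations M) (trivialFibrations M)]
    exact MorphismProperty.pullback_snd _ _ (rlp_matchingObjMap ih)
  refine ⟨h _, (weakEquivalences M).of_postcomp _ _ hsnd.2 ?_⟩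
  rw [relMatchingMap_snd]
  exact hw _

lemma SSetWeakEquivalence.homComplexMap_of_reedyFibrations [HasColimits M] {Z : M}
    (hZ : cofibrations M (initial.to Z)) (h : reedyFibrations (fibrations M) ψ)
    (hw : (weakEquivalences M).functorCategory _ ψ) :
    SSetWeakEquivalence (homComplexMap Z ψ) := by
  refine .of_rlp (rlp_homComplexMap_of_rlp_leibnizTensors hZ ?_)
  rw [rlp_leibnizTensors, MorphismProperty.rlp_eq_of_wfs (cofibrations M) (trivialFibrations M)]
  exact reedyFibrations_trivialFibrations h hw

end ReedyTrivialModel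

/-! ## Attaching cells to simplicial objects -/

section Copower

variable {C : Type u} [Category.{v} C] {X Y : C} {i : X ⟶ Y} {S S' : Type v}
  {j : S ⟶ S'}

lemma isIso_ι_of_isIso_right {C₁ C₂ C₃ : Type*} [Category C₁] [Category C₂] [Category C₃]
    {F : C₁ ⥤ C₂ ⥤ C₃} {X₁ Y₁ : C₁} {f₁ : X₁ ⟶ Y₁} {X₂ Y₂ : C₂} {f₂ : X₂ ⟶ Y₂}
    (sq : F.PushoutObjObj f₁ f₂) [IsIso f₂] : IsIso sq.ι := by
  have : IsIso sq.inl := (MorphismProperty.isomorphisms C₃).of_isPushout sq.isPushout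
    (inferInstanceAs (IsIso ((F.obj X₁).map f₂)))
  exact IsIso.of_isIso_fac_left sq.inl_ι

lemma hasLiftingProperty_coyoneda_π {E B : C} {p : E ⟶ B} [HasLiftingProperty i p]
    (hj : Function.Injective j) (sq : (coyoneda (C := C)).PullbackObjObj i p) :
    HasLiftingProperty j sq.π := by
  rw [hasLiftingProperty_pullback_iff j sq.isPullback sq.π_fst sq.π_snd]
  intro t x y hx hy hxy
  have exists_lift (s' : S') : ∃ l : Y ⟶ E, i ≫ l = x s' ∧ l ≫ p = y s' ∧
      ∀ s, j s = s' → l = t s := by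
    by_cases hs : ∃ s, j s = s'
    · obtain ⟨s, rfl⟩ := hs
      exact ⟨t s, ConcreteCategory.congr_hom hx s, ConcreteCategory.congr_hom hy s,
        fun s' h => by rw [hj h]⟩
    · have s : CommSq (x s' : X ⟶ E) i p (y s') := ⟨ConcreteCategory.congr_hom hxy s'⟩
      exact ⟨s.lift, s.fac_left, s.fac_right, fun s h => (hs ⟨s, h⟩).elim⟩
  choose l hlx hly hlt using exists_lift
  exact ⟨↾l, by ext s; exact hlt _ s rfl, by ext s'; exact hlx s', by ext s'; exact hly s'⟩

variable [HasColimits C]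

lemma llp_ι_of_injective {F : MorphismProperty C} (hi : F.llp i) (hj : Function.Injective j)
    (sq : (sigmaConst.{v} : C ⥤ Type v ⥤ C).PushoutObjObj i j) : F.llp sq.ι := fun _ _ p hp => by
  have := hi p hp
  exact ((copowerAdj C).hasLiftingProperty_iff sq (.ofHasPullback coyoneda i p)).2
    (hasLiftingProperty_coyoneda_π hj _)

variable (sq : (sigmaConst.{v} : C ⥤ Type v ⥤ C).PushoutObjObj i j)

lemma sigma_ι_inl_ι (s : S) :
    Sigma.ι (fun _ : S => Y) s ≫ sq.inl ≫ sq.ι = Sigma.ι (fun _ => Y) (j s) := by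
  simp [sq.inl_ι]

lemma sigma_ι_inr_ι (s : S') :
    Sigma.ι (fun _ : S' => X) s ≫ sq.inr ≫ sq.ι = i ≫ Sigma.ι (fun _ => Y) s := by
  simp [sq.inr_ι]

lemma sigma_ι_inr (s : S) : Sigma.ι (fun _ : S' => X) (j s) ≫ sq.inr =
    i ≫ Sigma.ι (fun _ : S => Y) s ≫ sq.inl := by
  simpa using (Sigma.ι (fun _ : S => X) s ≫= sq.isPushout.w).symm

lemma isPushout_ι_of_injective (hj : Function.Injective j) {s₀ : S'}
    (hs₀ : ∀ s', s' ∉ Set.range j ↔ s' = s₀) :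
    IsPushout (Sigma.ι (fun _ : S' => X) s₀ ≫ sq.inr) i sq.ι (Sigma.ι (fun _ : S' => Y) s₀) := by
  have eq_of_not_mem {s'} (h : ¬ ∃ s, j s = s') : s' = s₀ := (hs₀ s').1 h
  refine ⟨⟨by rw [Category.assoc, sigma_ι_inr_ι]⟩, ⟨PushoutCocone.isColimitAux' _ fun c => ?_⟩⟩
  have exists_desc (s' : S') : ∃ l : Y ⟶ c.pt, (∀ s, j s = s' →
      l = Sigma.ι (fun _ : S => Y) s ≫ sq.inl ≫ c.inl) ∧ (s' = s₀ → l = c.inr) ∧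
      i ≫ l = Sigma.ι (fun _ : S' => X) s' ≫ sq.inr ≫ c.inl := by
    by_cases hs : ∃ s, j s = s'
    · obtain ⟨s, rfl⟩ := hs
      refine ⟨_, fun s' h => by rw [hj h], fun h => ((hs₀ _).2 h ⟨s, rfl⟩).elim, ?_⟩
      rw [← reassoc_of% sigma_ι_inr sq]
    · obtain rfl := eq_of_not_mem hs
      exact ⟨c.inr, fun s h => (hs ⟨s, h⟩).elim, fun _ => rfl, by
        rw [← c.condition, Category.assoc]⟩
  choose l hl hl₀ hil using exists_desc
  have inl_desc : sq.ι ≫ Sigma.desc l = c.inl := by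
    refine sq.hom_ext (Sigma.hom_ext _ _ fun s => ?_) (Sigma.hom_ext _ _ fun s' => ?_)
    · rw [reassoc_of% sigma_ι_inl_ι sq s, Sigma.ι_desc, hl _ s rfl]
    · rw [reassoc_of% sigma_ι_inr_ι sq s', Sigma.ι_desc, hil]
  refine ⟨Sigma.desc l, inl_desc, (Sigma.ι_desc _ _).trans (hl₀ _ rfl), fun {m} hm hm₀ => ?_⟩
  refine Sigma.hom_ext _ _ fun s' => ?_
  rw [Sigma.ι_desc]
  by_cases hs : ∃ s, j s = s'
  · obtain ⟨s, rfl⟩ := hs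
    rw [hl _ s rfl, ← show sq.ι ≫ m = c.inl from hm]
    exact ((reassoc_of% sigma_ι_inl_ι sq s) m).symm
  · obtain rfl := eq_of_not_mem hs
    exact hm₀.trans (hl₀ _ rfl).symm

end Copower

section Attach

variable {C : Type u} [Category.{v} C] [HasColimits C]

/-- Evaluation at `n` of the pushout defining a Leibniz tensor. -/
noncomputable def leibnizTensorApp {X Y : C} (i : X ⟶ Y) {A B : SSet.{v}} (j : A ⟶ B)
    (n : SimplexCategoryᵒᵖ) : (sigmaConst.{v} : C ⥤ Type v ⥤ C).PushoutObjObj i (j.app n) where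
  pt := (leibnizTensor i j).pt.obj n
  inl := (leibnizTensor i j).inl.app n
  inr := (leibnizTensor i j).inr.app n
  isPushout := (leibnizTensor i j).isPushout.map ((evaluation _ _).obj n)
  ι := (leibnizTensor i j).ι.app n
  inl_ι := congr_app (leibnizTensor i j).inl_ι n
  inr_ι := congr_app (leibnizTensor i j).inr_ι n

variable {E E' : C} {R R' : SimplicialObject C} {n : ℕ}

/-- Maps out of the cell `E ⊗ Δ[n]`. -/
noncomputable def cellHomEquiv (E : C) (R : SimplicialObject C) (n : ℕ) :
    (((tensor C).obj E).obj Δ[n] ⟶ R) ≃ (E ⟶ R _⦋n⦌) :=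
  (tensorAdj C).homEquiv.trans (simplexHomEquiv E R n)

lemma cellHomEquiv_precomp (e : E' ⟶ E) (f : ((tensor C).obj E).obj Δ[n] ⟶ R) :
    cellHomEquiv E' R n (((tensor C).map e).app _ ≫ f) = e ≫ cellHomEquiv E R n f :=
  (congrArg (simplexHomEquiv _ _ n) ((tensorAdj C).homEquiv_naturality_one e f)).trans
    (simplexHomEquiv_precomp e _)

lemma cellHomEquiv_comp (f : ((tensor C).obj E).obj Δ[n] ⟶ R) (ψ : R ⟶ R') :
    cellHomEquiv E R' n (f ≫ ψ) = cellHomEquiv E R n f ≫ ψ.app _ :=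
  (congrArg (simplexHomEquiv _ _ n) ((tensorAdj C).homEquiv_naturality_three ψ f)).trans
    (simplexHomEquiv_map ψ _)

lemma sigma_ι_app_eq_cellHomEquiv (f : ((tensor C).obj E).obj Δ[n] ⟶ R) :
    Sigma.ι (fun _ => E) (SSet.yonedaEquiv (𝟙 Δ[n])) ≫ f.app (op ⦋n⦌) = cellHomEquiv E R n f :=
  rfl

variable [HasLimits C]

/-- Maps out of the boundary `E ⊗ ∂Δ[n]` of a cell. -/
noncomputable def cellBoundaryHomEquiv (E : C) (R : SimplicialObject C) (n : ℕ) :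
    (((tensor C).obj E).obj ∂Δ[n] ⟶ R) ≃ (E ⟶ limit (matchingDiagram R ⦋n⦌)) :=
  (tensorAdj C).homEquiv.trans (boundaryHomEquiv E R n)

lemma cellBoundaryHomEquiv_precomp (e : E' ⟶ E) (f : ((tensor C).obj E).obj ∂Δ[n] ⟶ R) :
    cellBoundaryHomEquiv E' R n (((tensor C).map e).app _ ≫ f) =
      e ≫ cellBoundaryHomEquiv E R n f :=
  (congrArg (boundaryHomEquiv _ _ n) ((tensorAdj C).homEquiv_naturality_one e f)).trans
    (boundaryHomEquiv_precomp e _)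

lemma cellBoundaryHomEquiv_comp (f : ((tensor C).obj E).obj ∂Δ[n] ⟶ R) (ψ : R ⟶ R') :
    cellBoundaryHomEquiv E R' n (f ≫ ψ) =
      cellBoundaryHomEquiv E R n f ≫ matchingObjMap ψ ⦋n⦌ :=
  (congrArg (boundaryHomEquiv _ _ n) ((tensorAdj C).homEquiv_naturality_three ψ f)).trans
    (boundaryHomEquiv_map ψ _)

lemma cellBoundaryHomEquiv_boundary_ι (f : ((tensor C).obj E).obj Δ[n] ⟶ R) :
    cellBoundaryHomEquiv E R n (((tensor C).obj E).map ∂Δ[n].ι ≫ f) =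
      cellHomEquiv E R n f ≫ matchingMap R ⦋n⦌ :=
  (congrArg (boundaryHomEquiv _ _ n) ((tensorAdj C).homEquiv_naturality_two ∂Δ[n].ι f)).trans
    (boundaryHomEquiv_boundary_ι _)

variable {e : R _⦋n⦌ ⟶ E} {x : E ⟶ limit (matchingDiagram R ⦋n⦌)}
  (hx : e ≫ x = matchingMap R ⦋n⦌)

/-- The attaching map of the cell `E`: it is the identity on `R _⦋n⦌` and `x` on the boundary
of `E`. -/
noncomputable def attachingMap : (leibnizTensor e ∂Δ[n].ι).pt ⟶ R :=
  (leibnizTensor e ∂Δ[n].ι).isPushout.desc ((cellBoundaryHomEquiv E R n).symm x)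
    ((cellHomEquiv _ R n).symm (𝟙 _)) <| (cellBoundaryHomEquiv _ R n).injective <| by
      rw [cellBoundaryHomEquiv_precomp, cellBoundaryHomEquiv_boundary_ι, Equiv.apply_symm_apply,
        Equiv.apply_symm_apply, hx, Category.id_comp]

lemma cellBoundaryHomEquiv_inl_attachingMap :
    cellBoundaryHomEquiv E R n ((leibnizTensor e ∂Δ[n].ι).inl ≫ attachingMap hx) = x := by
  rw [attachingMap, IsPushout.inl_desc, Equiv.apply_symm_apply]

lemma cellHomEquiv_inr_attachingMap :
    cellHomEquiv _ R n ((leibnizTensor e ∂Δ[n].ι).inr ≫ attachingMap hx) = 𝟙 _ := by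
  rw [attachingMap, IsPushout.inr_desc, Equiv.apply_symm_apply]

/-- The simplicial object obtained from `R` by replacing `R _⦋n⦌` with `E` and freely adding
degeneracies. -/
noncomputable abbrev attach : SimplicialObject C :=
  pushout (attachingMap hx) (leibnizTensor e ∂Δ[n].ι).ι

/-- The inclusion of `R` in `attach hx`. -/
noncomputable abbrev attachInl : R ⟶ attach hx :=
  pushout.inl _ _

/-- The inclusion of the attached cell, in degree `n`. -/
noncomputable def attachCell : E ⟶ (attach hx) _⦋n⦌ :=
  cellHomEquiv E _ n (pushout.inr _ _)

lemma attachCell_matchingMap :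
    attachCell hx ≫ matchingMap (attach hx) ⦋n⦌ = x ≫ matchingObjMap (attachInl hx) ⦋n⦌ := by
  rw [attachCell, ← cellBoundaryHomEquiv_boundary_ι, ← (leibnizTensor e ∂Δ[n].ι).inl_ι,
    Category.assoc, ← pushout.condition, ← Category.assoc, cellBoundaryHomEquiv_comp,
    cellBoundaryHomEquiv_inl_attachingMap]

lemma boundary_ι_app_injective (n : ℕ) (k : SimplexCategoryᵒᵖ) :
    Function.Injective ((∂Δ[n].ι : (∂Δ[n] : SSet.{v}) ⟶ _).app k) :=
  Subtype.val_injective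

lemma notMem_range_boundary_ι_app_iff (s : (Δ[n] : SSet.{v}).obj (op ⦋n⦌)) :
    s ∉ Set.range ((∂Δ[n].ι : (∂Δ[n] : SSet.{v}) ⟶ _).app (op ⦋n⦌)) ↔
      s = SSet.yonedaEquiv (𝟙 Δ[n]) := by
  obtain ⟨f, rfl⟩ := SSet.stdSimplex.objEquiv.symm.surjective s
  have mem_range_iff : SSet.stdSimplex.objEquiv.symm f ∈
      Set.range ((∂Δ[n].ι : (∂Δ[n] : SSet.{v}) ⟶ _).app (op ⦋n⦌)) ↔ ¬ Epi f := by
    rw [SimplexCategory.epi_iff_surjective]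
    exact ⟨fun ⟨s, hs⟩ => show SSet.stdSimplex.objEquiv.symm f ∈ ∂Δ[n].obj _ from hs ▸ s.2,
      fun h => ⟨⟨_, h⟩, rfl⟩⟩
  rw [mem_range_iff, not_not, show SSet.yonedaEquiv (𝟙 Δ[n]) = SSet.stdSimplex.objEquiv.symm (𝟙 ⦋n⦌)
    from rfl, EmbeddingLike.apply_eq_iff_eq]
  exact ⟨fun _ => SimplexCategory.eq_id_of_epi f, fun h => h ▸ inferInstanceAs (Epi (𝟙 ⦋n⦌))⟩

lemma isPushout_attach_app (k : SimplexCategoryᵒᵖ) :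
    IsPushout ((attachingMap hx).app k) ((leibnizTensor e ∂Δ[n].ι).ι.app k)
      ((attachInl hx).app k)
      ((pushout.inr (attachingMap hx) (leibnizTensor e ∂Δ[n].ι).ι).app k) :=
  (IsPushout.of_hasPushout _ _).map ((evaluation _ _).obj k)

instance isIso_attachCell : IsIso (attachCell hx) := by
  have sq := (isPushout_ι_of_injective (leibnizTensorApp e ∂Δ[n].ι (op ⦋n⦌))
    (boundary_ι_app_injective n _) notMem_range_boundary_ι_app_iff).paste_horiz
      (isPushout_attach_app hx (op ⦋n⦌))
  have attachingMap_id : (Sigma.ι (fun _ => R _⦋n⦌) (SSet.yonedaEquiv (𝟙 Δ[n])) ≫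
      (leibnizTensorApp e ∂Δ[n].ι (op ⦋n⦌)).inr) ≫ (attachingMap hx).app _ = 𝟙 _ := by
    rw [← cellHomEquiv_inr_attachingMap hx, ← sigma_ι_app_eq_cellHomEquiv]
    exact Category.assoc _ _ _
  rw [attachingMap_id] at sq
  exact (MorphismProperty.isomorphisms C).of_isPushout sq.flip (MorphismProperty.id_mem _ _)

lemma isIso_attachInl_app {k : ℕ} (hk : k < n) : IsIso ((attachInl hx).app (op ⦋k⦌)) := by
  have : IsIso ((∂Δ[n].ι : (∂Δ[n] : SSet.{v}) ⟶ _).app (op ⦋k⦌)) := by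
    rw [isIso_iff_bijective]
    exact ⟨boundary_ι_app_injective n _, fun s =>
      ⟨⟨s, by rw [SSet.boundary_obj_eq_univ k n hk]; trivial⟩, rfl⟩⟩
  exact (MorphismProperty.isomorphisms C).of_isPushout (isPushout_attach_app hx _)
    (isIso_ι_of_isIso_right (leibnizTensorApp e ∂Δ[n].ι (op ⦋k⦌)))

lemma llp_attachInl_app {F : MorphismProperty C} (he : F.llp e) (k : SimplexCategoryᵒᵖ) :
    F.llp ((attachInl hx).app k) :=
  MorphismProperty.of_isPushout (isPushout_attach_app hx k)
    (llp_ι_of_injective he (boundary_ι_app_injective n k) (leibnizTensorApp e ∂Δ[n].ι k))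

lemma exists_attach_desc {B : SimplicialObject C} (p : R ⟶ B) {y : E ⟶ B _⦋n⦌}
    (hey : e ≫ y = p.app _) (hxy : x ≫ matchingObjMap p ⦋n⦌ = y ≫ matchingMap B ⦋n⦌) :
    ∃ p' : attach hx ⟶ B, attachInl hx ≫ p' = p ∧ attachCell hx ≫ p'.app _ = y := by
  have w : attachingMap hx ≫ p =
      (leibnizTensor e ∂Δ[n].ι).ι ≫ (cellHomEquiv E B n).symm y := by
    refine (leibnizTensor e ∂Δ[n].ι).hom_ext ((cellBoundaryHomEquiv _ _ _).injective ?_)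
      ((cellHomEquiv _ _ _).injective ?_)
    · rw [← Category.assoc, cellBoundaryHomEquiv_comp, cellBoundaryHomEquiv_inl_attachingMap,
        Functor.PushoutObjObj.inl_ι_assoc, cellBoundaryHomEquiv_boundary_ι,
        Equiv.apply_symm_apply, hxy]
    · rw [← Category.assoc, cellHomEquiv_comp, cellHomEquiv_inr_attachingMap,
        Functor.PushoutObjObj.inr_ι_assoc, cellHomEquiv_precomp, Equiv.apply_symm_apply, hey,
        Category.id_comp]
  refine ⟨pushout.desc _ _ w, pushout.inl_desc _ _ _, ?_⟩
  rw [attachCell, ← cellHomEquiv_comp, pushout.inr_desc, Equiv.apply_symm_apply]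

end Attach

/-! ## Reedy factorizations -/

section RelMatchingMap

variable {C : Type u} [Category.{v} C] [HasLimits C] {R R' B : SimplicialObject C} {s : R ⟶ R'}
  {p : R ⟶ B} {p' : R' ⟶ B} {n : ℕ}

lemma isIso_matchingObjMap (hs : ∀ k < n, IsIso (s.app (op ⦋k⦌))) :
    IsIso (matchingObjMap s ⦋n⦌) := by
  have isIso_app (m : (ProperFace ⦋n⦌)ᵒᵖ) : IsIso (s.app (op m.unop.obj.left)) := by
    have : Mono m.unop.obj.hom := m.unop.property.1
    refine hs _ (lt_of_le_of_ne (SimplexCategory.len_le_of_mono m.unop.obj.hom) fun h => ?_)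
    exact m.unop.property.2 ((SimplexCategory.isIso_iff_of_mono m.unop.obj.hom).2 h)
  have : IsIso (Functor.whiskerLeft
      (ObjectProperty.ι _ ⋙ Over.forget (X := (⦋n⦌ : SimplexCategory))).op s :
        matchingDiagram R ⦋n⦌ ⟶ matchingDiagram R' ⦋n⦌) :=
    (NatTrans.isIso_iff_isIso_app _).2 isIso_app
  exact Functor.map_isIso lim _

variable {F : MorphismProperty C} [F.RespectsIso]

lemma relMatchingMap_mem_of_isIso_cell (hsp : s ≫ p' = p)
    (hs : ∀ k < n, IsIso (s.app (op ⦋k⦌))) {E : C} {ε : E ⟶ R' _⦋n⦌} [IsIso ε]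
    {g : E ⟶ pullback (matchingObjMap p ⦋n⦌) (matchingMap B ⦋n⦌)} (hg : F g)
    (hfst : ε ≫ matchingMap R' ⦋n⦌ = g ≫ pullback.fst _ _ ≫ matchingObjMap s ⦋n⦌)
    (hsnd : ε ≫ p'.app _ = g ≫ pullback.snd _ _) : F (relMatchingMap p' ⦋n⦌) := by
  subst hsp
  have := isIso_matchingObjMap hs
  let q := pullback.map (matchingObjMap (s ≫ p') ⦋n⦌) (matchingMap B ⦋n⦌) (matchingObjMap p' ⦋n⦌)
    (matchingMap B ⦋n⦌) (matchingObjMap s ⦋n⦌) (𝟙 _) (𝟙 _) (by simp [matchingObjMap_comp])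
    (by simp)
  have fac : ε ≫ relMatchingMap p' ⦋n⦌ = g ≫ q := by
    apply pullback.hom_ext
    · rw [Category.assoc, Category.assoc, relMatchingMap_fst, hfst, pullback.lift_fst]
    · rw [Category.assoc, Category.assoc, relMatchingMap_snd, hsnd, pullback.lift_snd,
        Category.comp_id]
  rwa [← F.cancel_left_of_respectsIso ε, fac, F.cancel_right_of_respectsIso g q]

lemma relMatchingMap_mem_of_isIso (hsp : s ≫ p' = p) (hs : ∀ k ≤ n, IsIso (s.app (op ⦋k⦌)))
    (hp : F (relMatchingMap p ⦋n⦌)) : F (relMatchingMap p' ⦋n⦌) := by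
  have := hs n le_rfl
  refine relMatchingMap_mem_of_isIso_cell hsp (fun k hk => hs k hk.le) (ε := s.app (op ⦋n⦌)) hp
    ?_ ?_
  · rw [← matchingMap_naturality, ← Category.assoc, relMatchingMap_fst]
  · rw [relMatchingMap_snd, ← hsp, NatTrans.comp_app]

end RelMatchingMap

lemma map_mem_of_map_succ_mem {C : Type*} [Category C] {W : MorphismProperty C}
    [W.IsMultiplicative] {G : ℕ ⥤ C} {N : ℕ}
    (h : ∀ m, N ≤ m → W (G.map (homOfLE m.le_succ))) {j : ℕ} (f : N ⟶ j) : W (G.map f) := by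
  obtain ⟨k, rfl⟩ := Nat.exists_eq_add_of_le (leOfHom f)
  induction k with
  | zero =>
    rw [Subsingleton.elim f (𝟙 N), G.map_id]
    exact W.id_mem _
  | succ k ih =>
    rw [Subsingleton.elim f (homOfLE (Nat.le_add_right N k) ≫ homOfLE (N + k).le_succ),
      G.map_comp]
    exact W.comp_mem _ _ (ih _) (h _ (Nat.le_add_right N k))

section Factorization

variable {C : Type u} [Category.{v} C] [HasLimits C] [HasColimits C] (L F : MorphismProperty C)
  [L.IsWeakFactorizationSystem F] {B : SimplicialObject C}

lemma exists_relMatchingMap_mem (n : ℕ) (X : Over B) :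
    ∃ (X' : Over B) (s : X ⟶ X'), L.functorCategory _ s.left ∧
      (∀ k < n, IsIso (s.left.app (op ⦋k⦌))) ∧ F (relMatchingMap X'.hom ⦋n⦌) := by
  have : F.RespectsIso := MorphismProperty.rlp_eq_of_wfs L F ▸ inferInstance
  let d := MorphismProperty.factorizationData L F (relMatchingMap X.hom ⦋n⦌)
  have hx : d.i ≫ d.p ≫ pullback.fst _ _ = matchingMap X.left ⦋n⦌ := by
    rw [d.fac_assoc, relMatchingMap_fst]
  obtain ⟨p', inl_p', cell_p'⟩ := exists_attach_desc hx X.hom (y := d.p ≫ pullback.snd _ _)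
    (by rw [d.fac_assoc, relMatchingMap_snd]) (by simp [pullback.condition])
  have isIso_inl (k) (hk : k < n) := isIso_attachInl_app hx hk
  have llp_eq := MorphismProperty.llp_eq_of_wfs L F
  exact ⟨Over.mk p', Over.homMk (attachInl hx) inl_p',
    fun k => llp_eq.le _ (llp_attachInl_app hx (llp_eq.ge _ d.hi) k), isIso_inl,
    relMatchingMap_mem_of_isIso_cell inl_p' isIso_inl d.hp
      ((attachCell_matchingMap hx).trans (Category.assoc _ _ _)) cell_p'⟩

lemma exists_sequence_relMatchingMap_mem (X : Over B) :
    ∃ (G : ℕ ⥤ Over B) (s : X ⟶ G.obj 0), L.functorCategory _ s.left ∧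
      ∀ n, L.functorCategory _ (G.map (homOfLE n.le_succ)).left ∧
        (∀ k < n, IsIso ((G.map (homOfLE n.le_succ)).left.app (op ⦋k⦌))) ∧
        F (relMatchingMap (G.obj (n + 1)).hom ⦋n⦌) := by
  have : L.IsMultiplicative := MorphismProperty.llp_eq_of_wfs L F ▸ inferInstance
  choose next s hs using fun n X => exists_relMatchingMap_mem (B := B) L F n X
  let Y : ℕ → Over B := fun n => Nat.rec X next n
  refine ⟨Functor.ofSequence (X := Y) fun n => s n (Y n), 𝟙 X, fun k => L.id_mem _, fun n => ?_⟩
  rw [Functor.ofSequence_map_homOfLE_succ]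
  exact hs n (Y n)

instance hasFactorization_reedyFibrations :
    (L.functorCategory SimplexCategoryᵒᵖ).HasFactorization (reedyFibrations F) where
  nonempty_mapFactorizationData {A B} φ := by
    have : F.RespectsIso := MorphismProperty.rlp_eq_of_wfs L F ▸ inferInstance
    have : L.IsMultiplicative := MorphismProperty.llp_eq_of_wfs L F ▸ inferInstance
    have : L.RespectsIso := MorphismProperty.llp_eq_of_wfs L F ▸ inferInstance
    obtain ⟨G, s, hs, hG⟩ := exists_sequence_relMatchingMap_mem L F (Over.mk φ)
    let H : ℕ ⥤ SimplicialObject C := G ⋙ Over.forget B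
    let c : Cocone H := ⟨B, { app n := (G.obj n).hom, naturality n m f := by simp [H] }⟩
    have isIso_ι (k n : ℕ) (hk : k ≤ n) : IsIso ((colimit.ι H (n + 1)).app (op ⦋k⦌)) := by
      have : (H ⋙ (evaluation _ _).obj (op ⦋k⦌)).IsEventuallyConstantFrom (n + 1) := fun j f =>
        map_mem_of_map_succ_mem (W := .isomorphisms C) (fun m hm => (hG m).2.1 k (by lia)) f
      exact this.isIso_ι_of_isColimit
        (isColimitOfPreserves ((evaluation _ _).obj (op ⦋k⦌)) (colimit.isColimit H))
    have ι_desc (n : ℕ) : colimit.ι H n ≫ colimit.desc H c = (G.obj n).hom := colimit.ι_desc _ _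
    have mem_ι (k : ℕ) : L ((colimit.ι H 0).app (op ⦋k⦌)) := by
      have := isIso_ι k k le_rfl
      rw [← colimit.w H (homOfLE (Nat.zero_le (k + 1)))]
      exact (L.cancel_right_of_respectsIso _ _).2
        (map_mem_of_map_succ_mem (G := H ⋙ (evaluation _ _).obj (op ⦋k⦌))
          (fun m _ => (hG m).1 _) _)
    exact ⟨{
      Z := colimit H
      i := s.left ≫ colimit.ι H 0
      p := colimit.desc H c
      fac := (Category.assoc _ _ _).trans ((congrArg (s.left ≫ ·) (ι_desc 0)).trans (Over.w s))
      hi k := L.comp_mem _ _ (hs k) (mem_ι k.unop.len)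
      hp n := relMatchingMap_mem_of_isIso (ι_desc (n.len + 1))
        (fun k hk => isIso_ι k n.len hk) (hG n.len).2.2 }⟩

end Factorization

/-! ## Invariance of function complexes -/

section Invariance

variable {M : Type u} [Category.{v} M]

instance functorCategory_hasTwoOutOfThreeProperty {J : Type*} [Category* J]
    (W : MorphismProperty M) [W.HasTwoOutOfThreeProperty] :
    (W.functorCategory J).HasTwoOutOfThreeProperty where
  comp_mem _ _ hf hg j := W.comp_mem _ _ (hf j) (hg j)
  of_postcomp _ _ hg hfg j := W.of_postcomp _ _ (hg j) (hfg j)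
  of_precomp _ _ hf hfg j := W.of_precomp _ _ (hf j) (hfg j)

lemma homComplexMap_comp (Z : M) {R R' R'' : SimplicialObject M} (φ : R ⟶ R') (ψ : R' ⟶ R'') :
    homComplexMap Z (φ ≫ ψ) = homComplexMap Z φ ≫ homComplexMap Z ψ :=
  Functor.whiskerRight_comp _ _ _

lemma homComplexMap_id (Z : M) (R : SimplicialObject M) : homComplexMap Z (𝟙 R) = 𝟙 _ :=
  Functor.whiskerRight_id _

variable (M) in
/-- The levelwise weak equivalences of simplicial objects, for which Reedy fibrant replacements
are compared. -/
abbrev levelwiseWeakEquivalences [ModelCategory M] : MorphismProperty (SimplicialObject M) :=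
  (weakEquivalences M).functorCategory _

variable [ModelCategory M] [HasLimits M]

lemma isReedyFibrant_iff (R : SimplicialObject M) :
    (modelClasses M).IsReedyFibrant R ↔ reedyFibrations (fibrations M) (terminal.from R) :=
  (reedyFibrations_iff_of_isTerminal (fibrations M) terminalIsTerminal).symm

variable [HasColimits M]

lemma rlp_leibnizTensors_trivialCofibrations :
    (leibnizTensors (trivialCofibrations M)).rlp = reedyFibrations (fibrations M) := by
  rw [rlp_leibnizTensors, MorphismProperty.rlp_eq_of_wfs (trivialCofibrations M) (fibrations M)]

instance reedyFibrations_isMultiplicative : (reedyFibrations (fibrations M)).IsMultiplicative :=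
  rlp_leibnizTensors_trivialCofibrations (M := M) ▸ inferInstance

instance reedyFibrations_isStableUnderBaseChange :
    (reedyFibrations (fibrations M)).IsStableUnderBaseChange :=
  rlp_leibnizTensors_trivialCofibrations (M := M) ▸ inferInstance

lemma reedyFibrations_prod_fst {R Q : SimplicialObject M}
    (hQ : (modelClasses M).IsReedyFibrant Q) :
    reedyFibrations (fibrations M) (prod.fst : R ⨯ Q ⟶ R) :=
  MorphismProperty.of_isPullback (IsPullback.of_hasBinaryProduct' _ _).flip
    ((isReedyFibrant_iff Q).1 hQ)

lemma reedyFibrations_prod_snd {R Q : SimplicialObject M}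
    (hR : (modelClasses M).IsReedyFibrant R) :
    reedyFibrations (fibrations M) (prod.snd : R ⨯ Q ⟶ Q) :=
  MorphismProperty.of_isPullback (IsPullback.of_hasBinaryProduct' _ _)
    ((isReedyFibrant_iff R).1 hR)

/-- The Reedy fibrations which are levelwise weak equivalences, i.e. the trivial fibrations of the
Reedy model structure. -/
def trivialReedyFibrations (M : Type u) [Category.{v} M] [ModelCategory M] [HasLimits M] :
    MorphismProperty (SimplicialObject M) :=
  reedyFibrations (fibrations M) ⊓ levelwiseWeakEquivalences M

lemma exists_span_trivialReedyFibrations {C P R Q : SimplicialObject M} {p₁ : P ⟶ R} {p₂ : P ⟶ Q}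
    (hp₁ : reedyFibrations (fibrations M) p₁) (hp₂ : reedyFibrations (fibrations M) p₂)
    (a : C ⟶ P) (ha₁ : levelwiseWeakEquivalences M (a ≫ p₁))
    (ha₂ : levelwiseWeakEquivalences M (a ≫ p₂)) :
    ∃ (E : SimplicialObject M) (a' : C ⟶ E) (p : E ⟶ P), a' ≫ p = a ∧
      reedyFibrations (fibrations M) p ∧
      trivialReedyFibrations M (p ≫ p₁) ∧ trivialReedyFibrations M (p ≫ p₂) := by
  obtain ⟨E, a', p, rfl, ha', hp⟩ := MorphismProperty.factorizationData
    ((trivialCofibrations M).functorCategory _) (reedyFibrations (fibrations M)) a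
  rw [Category.assoc] at ha₁ ha₂
  have ha'_weq : levelwiseWeakEquivalences M a' := fun n => (ha' n).2
  exact ⟨E, a', p, rfl, hp,
    ⟨MorphismProperty.comp_mem _ _ _ hp hp₁, MorphismProperty.of_precomp _ _ _ ha'_weq ha₁⟩,
    ⟨MorphismProperty.comp_mem _ _ _ hp hp₂, MorphismProperty.of_precomp _ _ _ ha'_weq ha₂⟩⟩

lemma exists_zigzag_trivialReedyFibrations {CA CB RA RB QA QB : SimplicialObject M}
    {c : CA ⟶ CB} {r : RA ⟶ RB} {q : QA ⟶ QB}
    {iA : CA ⟶ RA} {iB : CB ⟶ RB} {jA : CA ⟶ QA} {jB : CB ⟶ QB}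
    (hiA : levelwiseWeakEquivalences M iA) (hiB : levelwiseWeakEquivalences M iB)
    (hjA : levelwiseWeakEquivalences M jA) (hjB : levelwiseWeakEquivalences M jB)
    (hi : iA ≫ r = c ≫ iB) (hj : jA ≫ q = c ≫ jB)
    (hRA : (modelClasses M).IsReedyFibrant RA) (hRB : (modelClasses M).IsReedyFibrant RB)
    (hQA : (modelClasses M).IsReedyFibrant QA) (hQB : (modelClasses M).IsReedyFibrant QB) :
    ∃ (EA EB : SimplicialObject M) (e : EA ⟶ EB) (rA : EA ⟶ RA) (qA : EA ⟶ QA)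
      (rB : EB ⟶ RB) (qB : EB ⟶ QB), e ≫ rB = rA ≫ r ∧ e ≫ qB = qA ≫ q ∧
      trivialReedyFibrations M rA ∧ trivialReedyFibrations M qA ∧
      trivialReedyFibrations M rB ∧ trivialReedyFibrations M qB := by
  obtain ⟨EB, aB, pB, haB, hpB, hrB, hqB⟩ := exists_span_trivialReedyFibrations
    (reedyFibrations_prod_fst hQB) (reedyFibrations_prod_snd hRB) (prod.lift iB jB)
    (by rwa [prod.lift_fst]) (by rwa [prod.lift_snd])
  have h : (c ≫ aB) ≫ pB = prod.lift iA jA ≫ prod.map r q := by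
    rw [Category.assoc, haB, prod.comp_lift, prod.lift_map, hi, hj]
  have hsnd : reedyFibrations (fibrations M) (pullback.snd pB (prod.map r q)) :=
    MorphismProperty.pullback_snd _ _ hpB
  obtain ⟨EA, aA, pA, -, -, hrA, hqA⟩ := exists_span_trivialReedyFibrations
    (MorphismProperty.comp_mem _ _ _ hsnd (reedyFibrations_prod_fst hQA))
    (MorphismProperty.comp_mem _ _ _ hsnd (reedyFibrations_prod_snd hRA))
    (pullback.lift _ _ h) (by rwa [pullback.lift_snd_assoc, prod.lift_fst])
    (by rwa [pullback.lift_snd_assoc, prod.lift_snd])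
  exact ⟨EA, EB, pA ≫ pullback.fst _ _, _, _, _, _,
    by simp [pullback.condition_assoc], by simp [pullback.condition_assoc], hrA, hqA, hrB, hqB⟩

lemma SSetWeakEquivalence.homComplexMap_of_zigzag {Z : M} (hZ : cofibrations M (initial.to Z))
    {CA CB RA RB QA QB : SimplicialObject M} {c : CA ⟶ CB} {r : RA ⟶ RB} {q : QA ⟶ QB}
    {iA : CA ⟶ RA} {iB : CB ⟶ RB} {jA : CA ⟶ QA} {jB : CB ⟶ QB}
    (hiA : levelwiseWeakEquivalences M iA) (hiB : levelwiseWeakEquivalences M iB)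
    (hjA : levelwiseWeakEquivalences M jA) (hjB : levelwiseWeakEquivalences M jB)
    (hi : iA ≫ r = c ≫ iB) (hj : jA ≫ q = c ≫ jB)
    (hRA : (modelClasses M).IsReedyFibrant RA) (hRB : (modelClasses M).IsReedyFibrant RB)
    (hQA : (modelClasses M).IsReedyFibrant QA) (hQB : (modelClasses M).IsReedyFibrant QB)
    (h : SSetWeakEquivalence (homComplexMap Z r)) : SSetWeakEquivalence (homComplexMap Z q) := by
  obtain ⟨EA, EB, e, rA, qA, rB, qB, hr, hq, hrA, hqA, hrB, hqB⟩ :=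
    exists_zigzag_trivialReedyFibrations hiA hiB hjA hjB hi hj hRA hRB hQA hQB
  have weq {E R : SimplicialObject M} {p : E ⟶ R} (hp : trivialReedyFibrations M p) :
      SSetWeakEquivalence (homComplexMap Z p) := homComplexMap_of_reedyFibrations hZ hp.1 hp.2
  have he : SSetWeakEquivalence (homComplexMap Z e) := by
    refine of_postcomp (weq hrB) ?_
    rw [← homComplexMap_comp, hr, homComplexMap_comp]
    exact (weq hrA).comp h
  refine of_precomp (weq hqA) ?_
  rw [← homComplexMap_comp, ← hq, homComplexMap_comp]
  exact he.comp (weq hqB)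

lemma SSetWeakEquivalence.homComplexMap_of_levelwise {Z : M}
    (hZ : cofibrations M (initial.to Z)) {R Q : SimplicialObject M} {φ : R ⟶ Q}
    (hφ : levelwiseWeakEquivalences M φ) (hR : (modelClasses M).IsReedyFibrant R)
    (hQ : (modelClasses M).IsReedyFibrant Q) : SSetWeakEquivalence (homComplexMap Z φ) := by
  have id_mem (R : SimplicialObject M) : levelwiseWeakEquivalences M (𝟙 R) := fun _ =>
    (weakEquivalences M).id_mem _
  refine homComplexMap_of_zigzag hZ (c := φ) (r := 𝟙 Q) (q := φ) hφ (id_mem Q) (id_mem R)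
    (id_mem Q) rfl (by simp) hQ hQ hR hQ ?_
  rw [homComplexMap_id]
  exact of_isIso _

lemma exists_mapResolution {A B : M} (f : A ⟶ B) :
    ∃ (P : (modelClasses M).MapResolution f) (iA : (SimplicialObject.const M).obj A ⟶ P.RA)
      (iB : (SimplicialObject.const M).obj B ⟶ P.RB),
      levelwiseWeakEquivalences M iA ∧ levelwiseWeakEquivalences M iB ∧
      iA ≫ P.res = (SimplicialObject.const M).map f ≫ iB := by
  obtain ⟨RB, iB, pB, -, hiB, hpB⟩ := MorphismProperty.factorizationData
    ((trivialCofibrations M).functorCategory _) (reedyFibrations (fibrations M))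
    (terminal.from ((SimplicialObject.const M).obj B))
  obtain ⟨RA, iA, r, hr, hiA, hrF⟩ := MorphismProperty.factorizationData
    ((trivialCofibrations M).functorCategory _) (reedyFibrations (fibrations M))
    ((SimplicialObject.const M).map f ≫ iB)
  have hRB : reedyFibrations (fibrations M) (terminal.from RB) := by
    rwa [terminalIsTerminal.hom_ext (terminal.from RB) pB]
  have hRA : reedyFibrations (fibrations M) (terminal.from RA) := by
    rw [terminalIsTerminal.hom_ext (terminal.from RA) (r ≫ terminal.from RB)]
    exact MorphismProperty.comp_mem _ _ _ hrF hRB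
  exact ⟨{
    A' := A
    B' := B
    f' := f
    a := 𝟙 A
    b := 𝟙 B
    weq_a := (weakEquivalences M).id_mem A
    weq_b := (weakEquivalences M).id_mem B
    comm := by rw [Category.id_comp, Category.comp_id]
    RA := RA
    RB := RB
    iA := iA
    iB := iB
    resolution_iA := ⟨fun n => (hiA n).2, (isReedyFibrant_iff RA).2 hRA⟩
    resolution_iB := ⟨fun n => (hiB n).2, (isReedyFibrant_iff RB).2 hRB⟩
    res := r
    comm_res := hr }, iA, iB, fun n => (hiA n).2, fun n => (hiB n).2, hr⟩

lemma mapWeq_iff {Z : M} (hZ : cofibrations M (initial.to Z)) {A B : M} {f : A ⟶ B}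
    (P : (modelClasses M).MapResolution f) :
    (modelClasses M).MapWeq Z f ↔ SSetWeakEquivalence (homComplexMap Z P.res) := by
  obtain ⟨R, iA, iB, hiA, hiB, comm⟩ := exists_mapResolution f
  have const_mem {A B : M} {f : A ⟶ B} (hf : weakEquivalences M f) :
      levelwiseWeakEquivalences M ((SimplicialObject.const M).map f) := fun _ => hf
  have iff_R (Q : (modelClasses M).MapResolution f) :
      SSetWeakEquivalence (homComplexMap Z Q.res) ↔
        SSetWeakEquivalence (homComplexMap Z R.res) := by
    have hA := MorphismProperty.comp_mem _ _ _ (const_mem Q.weq_a) hiA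
    have hB := MorphismProperty.comp_mem _ _ _ (const_mem Q.weq_b) hiB
    have comm_Q : ((SimplicialObject.const M).map Q.a ≫ iA) ≫ R.res =
        (SimplicialObject.const M).map Q.f' ≫ (SimplicialObject.const M).map Q.b ≫ iB := by
      rw [Category.assoc, comm, ← Functor.map_comp_assoc, Q.comm, Functor.map_comp_assoc]
    exact ⟨.homComplexMap_of_zigzag hZ Q.resolution_iA.weq Q.resolution_iB.weq hA hB
        Q.comm_res comm_Q Q.resolution_iA.reedyFibrant Q.resolution_iB.reedyFibrant
        R.resolution_iA.reedyFibrant R.resolution_iB.reedyFibrant,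
      .homComplexMap_of_zigzag hZ hA hB Q.resolution_iA.weq Q.resolution_iB.weq
        comm_Q Q.comm_res R.resolution_iA.reedyFibrant R.resolution_iB.reedyFibrant
        Q.resolution_iA.reedyFibrant Q.resolution_iB.reedyFibrant⟩
  exact ⟨fun h => h P, fun h Q => (iff_R Q).2 ((iff_R P).1 h)⟩

lemma mapWeq_of_weakEquivalences {Z : M} (hZ : cofibrations M (initial.to Z)) {A B : M}
    {f : A ⟶ B} (hf : weakEquivalences M f) : (modelClasses M).MapWeq Z f := by
  obtain ⟨P, iA, iB, hiA, hiB, comm⟩ := exists_mapResolution f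
  have hfB : levelwiseWeakEquivalences M (iA ≫ P.res) :=
    comm ▸ MorphismProperty.comp_mem _ _ _ (fun _ => hf) hiB
  exact (mapWeq_iff hZ P).2 <| .homComplexMap_of_levelwise hZ
    (MorphismProperty.of_precomp _ _ _ hiA hfB)
    P.resolution_iA.reedyFibrant P.resolution_iB.reedyFibrant

end Invariance

/-! ## Whitehead's theorem -/

section Whitehead

variable {M : Type u} [Category.{v} M] [ModelCategory M]

lemma weakEquivalences_of_section {X Y A : M} {f : X ⟶ Y} {σ : Y ⟶ A} {p : A ⟶ Y}
    (hσ : σ ≫ p = 𝟙 Y) (h : weakEquivalences M (f ≫ σ)) : weakEquivalences M f := by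
  let W := weakEquivalences M
  have hpσ : W (p ≫ σ) := W.of_precomp (f ≫ σ) _ h (by simpa [reassoc_of% hσ] using h)
  have p_retract : RetractArrow p (p ≫ σ) :=
    { i := Arrow.homMk (𝟙 A) σ (by simp)
      r := Arrow.homMk (𝟙 A) p (by simp [hσ])
      retract := by ext <;> simp [hσ] }
  have hσ_weq : W σ := W.of_postcomp _ p (W.of_retract p_retract hpσ) (hσ ▸ W.id_mem Y)
  exact W.of_postcomp _ σ hσ_weq h

lemma weakEquivalences_of_two_out_of_six {X Y A B : M} {f : X ⟶ Y} {s : Y ⟶ A} {p : A ⟶ B}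
    (hfs : weakEquivalences M (f ≫ s)) (hsp : weakEquivalences M (s ≫ p)) :
    weakEquivalences M f := by
  let W := weakEquivalences M
  -- The lift of `s` along `j` is a section `σ` of the pullback of `p'` along the trivial fibration
  -- `r`, to which `weakEquivalences_of_section` applies.
  obtain ⟨A', i, p', rfl, hi, hp'⟩ :=
    MorphismProperty.factorizationData (trivialCofibrations M) (fibrations M) p
  obtain ⟨E, j, r, hjr, hj, hr⟩ :=
    MorphismProperty.factorizationData (trivialCofibrations M) (fibrations M) (s ≫ i ≫ p')
  have hr_triv : trivialFibrations M r := ⟨hr, W.of_precomp j r hj.2 (by rwa [hjr])⟩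
  have hfst : trivialFibrations M (pullback.fst p' r) := by
    rw [← MorphismProperty.rlp_eq_of_wfs (cofibrations M) (trivialFibrations M)] at hr_triv ⊢
    exact MorphismProperty.pullback_fst _ _ hr_triv
  have : HasLiftingProperty j p' := by
    rw [← MorphismProperty.llp_eq_of_wfs (trivialCofibrations M) (fibrations M)] at hj
    exact hj _ hp'
  have sq : CommSq (s ≫ i) j p' r := ⟨by rw [hjr, Category.assoc]⟩
  let σ : E ⟶ pullback p' r := pullback.lift sq.lift (𝟙 E) (by simp)
  have σ_fst : σ ≫ pullback.fst p' r = sq.lift := pullback.lift_fst _ _ _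
  have hfjσ : W ((f ≫ j) ≫ σ) := by
    refine W.of_postcomp _ (pullback.fst p' r) hfst.2 ?_
    have fac : ((f ≫ j) ≫ σ) ≫ pullback.fst p' r = (f ≫ s) ≫ i := by
      rw [Category.assoc, σ_fst, Category.assoc, sq.fac_left, Category.assoc]
    rw [fac]
    exact W.comp_mem _ _ hfs hi.2
  exact W.of_postcomp f j hj.2 (weakEquivalences_of_section (pullback.lift_snd _ _ _) hfjσ)

/-- The homotopy class of a morphism `X ⟶ R₀`, which is a vertex of `C(X, R)`. -/
def π₀Class {C : Type u} [Category.{v} C] {X : C} {R : SimplicialObject C} (x : X ⟶ R _⦋0⦌) :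
    SSet.π₀ (homComplex X R) :=
  .mk x

section π₀Class

variable {C : Type u} [Category.{v} C] {X Y : C} {R R' : SimplicialObject C}

lemma π₀Class_surjective : Function.Surjective (π₀Class : (X ⟶ R _⦋0⦌) → _) :=
  SSet.π₀.mk_surjective

lemma mapπ₀_homComplexMap_π₀Class (φ : R ⟶ R') (x : X ⟶ R _⦋0⦌) :
    SSet.mapπ₀ (homComplexMap X φ) (π₀Class x) = π₀Class (x ≫ φ.app _) :=
  SSet.mapπ₀_mk _ _

lemma mapπ₀_homComplexPrecomp_π₀Class (f : X ⟶ Y) (y : Y ⟶ R _⦋0⦌) :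
    SSet.mapπ₀ (homComplexPrecomp f R) (π₀Class y) = π₀Class (f ≫ y) :=
  SSet.mapπ₀_mk _ _

end π₀Class

lemma weakEquivalences_iff_of_π₀Class_eq {A : M} {R : SimplicialObject M}
    {i : (SimplicialObject.const M).obj A ⟶ R} (hi : levelwiseWeakEquivalences M i) {X : M}
    {x y : X ⟶ R _⦋0⦌} (h : π₀Class x = π₀Class y) :
    weakEquivalences M x ↔ weakEquivalences M y := by
  let W := weakEquivalences M
  have hδ (k : Fin 2) : W (R.δ k) := by
    refine W.of_precomp (i.app _) _ (hi _) ?_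
    rw [SimplicialObject.δ, ← i.naturality]
    exact W.comp_mem _ _ (W.id_mem A) (hi _)
  have comp_δ_iff (z : X ⟶ R _⦋1⦌) (k : Fin 2) : W (z ≫ R.δ k) ↔ W z :=
    ⟨W.of_postcomp _ _ (hδ k), fun hz => W.comp_mem _ _ hz (hδ k)⟩
  let isWeq (x : (homComplex X R) _⦋0⦌) : Prop := W (show X ⟶ R _⦋0⦌ from x)
  have isWeq_edge ⦃x y : (homComplex X R) _⦋0⦌⦄ (e : SSet.Edge x y) : isWeq x = isWeq y := by
    obtain ⟨z, rfl, rfl⟩ : ∃ z : X ⟶ R _⦋1⦌, z ≫ R.δ 1 = x ∧ z ≫ R.δ 0 = y :=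
      ⟨e.edge, e.src_eq, e.tgt_eq⟩
    exact propext ((comp_δ_iff z 1).trans (comp_δ_iff z 0).symm)
  exact iff_of_eq (congrArg (SSet.π₀.lift isWeq isWeq_edge) h)

variable [HasLimits M] [HasColimits M]

/-- The coaugmentation of `Y` lifts along `f` to a homotopy section `s`: surjectivity of
`π₀ map(Y, f)` makes `s ≫ f` a weak equivalence, and then injectivity of `π₀ map(X, f)` makes
`f ≫ s` one. -/
lemma weakEquivalences_of_mapWeq {X Y : M} {f : X ⟶ Y} (hX : (modelClasses M).MapWeq X f)
    (hY : (modelClasses M).MapWeq Y f) : weakEquivalences M f := by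
  obtain ⟨P, iA, iB, hiA, hiB, comm⟩ := exists_mapResolution f
  let x : X ⟶ P.RA _⦋0⦌ := iA.app _
  let y : Y ⟶ P.RB _⦋0⦌ := iB.app _
  have hxy : x ≫ P.res.app _ = f ≫ y := congr_app comm _
  obtain ⟨t, ht⟩ := (hY P).mapπ₀_surjective (π₀Class y)
  obtain ⟨s, rfl⟩ := π₀Class_surjective t
  rw [mapπ₀_homComplexMap_π₀Class] at ht
  have hs : weakEquivalences M (s ≫ P.res.app _) :=
    (weakEquivalences_iff_of_π₀Class_eq hiB ht).2 (hiB _)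
  have hfs : π₀Class (f ≫ s) = π₀Class x := by
    refine (hX P).mapπ₀_injective ?_
    rw [mapπ₀_homComplexMap_π₀Class, mapπ₀_homComplexMap_π₀Class, hxy, Category.assoc,
      ← mapπ₀_homComplexPrecomp_π₀Class, ht, mapπ₀_homComplexPrecomp_π₀Class]
  exact weakEquivalences_of_two_out_of_six
    ((weakEquivalences_iff_of_π₀Class_eq hiA hfs).2 (hiA _)) hs

end Whitehead

/-! ## Free algebras -/

section Adjunction

variable {C : Type u} [Category.{v} C] {D : Type u'} [Category.{v} D] {F : C ⥤ D} {G : D ⥤ C}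

/-- The isomorphism `D(F Z, R) ≅ C(Z, G R)` of function complexes induced by an adjunction. -/
noncomputable def homComplexIso (adj : F ⊣ G) (Z : C) (R : SimplicialObject D) :
    homComplex (F.obj Z) R ≅ homComplex Z (R ⋙ G) :=
  NatIso.ofComponents (fun n => (adj.homEquiv Z (R.obj n)).toIso) fun θ => by
    ext x
    exact adj.homEquiv_naturality_right x (R.map θ)

lemma homComplexMap_comp_homComplexIso_hom (adj : F ⊣ G) (Z : C) {R R' : SimplicialObject D}
    (φ : R ⟶ R') : homComplexMap (F.obj Z) φ ≫ (homComplexIso adj Z R').hom =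
      (homComplexIso adj Z R).hom ≫ homComplexMap Z (Functor.whiskerRight φ G) := by
  ext n x
  exact adj.homEquiv_naturality_right x (φ.app n)

lemma sSetWeakEquivalence_homComplexMap_leftAdjoint_iff (adj : F ⊣ G) (Z : C)
    {R R' : SimplicialObject D} (φ : R ⟶ R') :
    SSetWeakEquivalence (homComplexMap (F.obj Z) φ) ↔
      SSetWeakEquivalence (homComplexMap Z (Functor.whiskerRight φ G)) := by
  have comm := homComplexMap_comp_homComplexIso_hom adj Z φ
  constructor
  · intro h
    exact .of_precomp (.of_isIso (homComplexIso adj Z R).hom) (comm ▸ h.comp (.of_isIso _))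
  · intro h
    exact .of_postcomp (.of_isIso (homComplexIso adj Z R').hom)
      (comm ▸ SSetWeakEquivalence.comp (.of_isIso _) h)

lemma hasLiftingProperty_initial_to_leftAdjoint_iff [HasInitial C] [HasInitial D] (adj : F ⊣ G)
    {X : C} {A B : D} (p : A ⟶ B) :
    HasLiftingProperty (initial.to (F.obj X)) p ↔
      HasLiftingProperty (initial.to X) (G.map p) := by
  have : PreservesColimitsOfSize.{0, 0} F := adj.leftAdjoint_preservesColimits
  let e : ⊥_ D ≅ F.obj (⊥_ C) :=
    initialIsInitial.uniqueUpToIso (initialIsInitial.isInitialObj F)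
  rw [← adj.hasLiftingProperty_iff]
  exact HasLiftingProperty.iff_of_arrow_iso_left
    (Arrow.isoMk e (Iso.refl _) (initialIsInitial.hom_ext _ _)) p

/-- The map `const (G A) ⟶ G R` obtained by applying `G` to a coaugmentation `const A ⟶ R`. -/
def mapCoaugmentation (G : D ⥤ C) {A : D} {R : SimplicialObject D}
    (i : (SimplicialObject.const D).obj A ⟶ R) :
    (SimplicialObject.const C).obj (G.obj A) ⟶ R ⋙ G where
  app n := G.map (i.app n)
  naturality n m θ :=
    calc 𝟙 _ ≫ G.map (i.app m) = G.map (𝟙 A ≫ i.app m) := by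
          rw [Category.id_comp, Category.id_comp]
      _ = G.map (i.app n ≫ R.map θ) := congrArg G.map (i.naturality θ)
      _ = G.map (i.app n) ≫ G.map (R.map θ) := G.map_comp _ _

lemma map_matchingMap_comp_preservesLimitIso_hom [HasLimits C] [HasLimits D] (G : D ⥤ C)
    (R : SimplicialObject D) (n : SimplexCategory) [PreservesLimit (matchingDiagram R n) G] :
    G.map (matchingMap R n) ≫ (preservesLimitIso G (matchingDiagram R n)).hom =
      matchingMap (R ⋙ G) n := by
  refine limit.hom_ext fun m => ?_
  refine (Category.assoc _ _ _).trans ((congrArg (G.map (matchingMap R n) ≫ ·)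
    (preservesLimitIso_hom_π G (matchingDiagram R n) m)).trans ?_)
  rw [← Functor.map_comp, matchingMap_π]
  exact (matchingMap_π (R ⋙ G) n m).symm

end Adjunction

section ForgetResolution

variable {M : Type u} [Category.{v} M] [HasLimits M] {T : Monad M} {S : Classes M}
  [S.fib.RespectsIso]

lemma isReedyFibrant_comp_forget {R : SimplicialObject T.Algebra}
    (hR : (algClasses T S).IsReedyFibrant R) : S.IsReedyFibrant (R ⋙ T.forget) := fun n => by
  rw [← map_matchingMap_comp_preservesLimitIso_hom, S.fib.cancel_right_of_respectsIso]
  exact hR n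

lemma isSimplicialResolution_forget {A : T.Algebra} {R : SimplicialObject T.Algebra}
    {i : (SimplicialObject.const _).obj A ⟶ R} (hi : (algClasses T S).IsSimplicialResolution i) :
    S.IsSimplicialResolution (mapCoaugmentation T.forget i) :=
  ⟨fun n => hi.weq n, isReedyFibrant_comp_forget hi.reedyFibrant⟩

/-- The resolution of the underlying morphism of a morphism of algebras obtained from a resolution
of the latter. -/
def Classes.MapResolution.forget {A B : T.Algebra} {g : A ⟶ B}
    (P : (algClasses T S).MapResolution g) : S.MapResolution (T.forget.map g) where
  A' := T.forget.obj P.A'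
  B' := T.forget.obj P.B'
  f' := T.forget.map P.f'
  a := T.forget.map P.a
  b := T.forget.map P.b
  weq_a := P.weq_a
  weq_b := P.weq_b
  comm := by rw [← Functor.map_comp, P.comm, Functor.map_comp]
  RA := P.RA ⋙ T.forget
  RB := P.RB ⋙ T.forget
  iA := mapCoaugmentation T.forget P.iA
  iB := mapCoaugmentation T.forget P.iB
  resolution_iA := isSimplicialResolution_forget P.resolution_iA
  resolution_iB := isSimplicialResolution_forget P.resolution_iB
  res := Functor.whiskerRight P.res T.forget
  comm_res := by
    ext n
    have h := congrArg T.forget.map (congr_app P.comm_res n)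
    exact (T.forget.map_comp _ _).symm.trans (h.trans (T.forget.map_comp _ _))

lemma mapWeq_free {Z : M} {A B : T.Algebra} {g : A ⟶ B} (h : S.MapWeq Z (T.forget.map g)) :
    (algClasses T S).MapWeq (T.free.obj Z) g := fun P =>
  (sSetWeakEquivalence_homComplexMap_leftAdjoint_iff T.adj Z P.res).2 (h P.forget)

end ForgetResolution

section FreeAlgebras

variable {M : Type u} [Category.{v} M] [ModelCategory M] {T : Monad M}

instance respectsIso_modelClasses_fib : (modelClasses M).fib.RespectsIso :=
  inferInstanceAs (fibrations M).RespectsIso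

lemma isCofibrant_free [HasColimits T.Algebra] {X : M} (hX : cofibrations M (initial.to X)) :
    (algClasses T (modelClasses M)).IsCofibrant (T.free.obj X) := fun _ _ p hp => by
  rw [← MorphismProperty.llp_eq_of_wfs (cofibrations M) (trivialFibrations M)] at hX
  exact (hasLiftingProperty_initial_to_leftAdjoint_iff T.adj p).2 (hX _ hp)

variable [HasLimits M]

section Colocal

variable [HasColimits M] {K : Set M} (hK : ∀ X ∈ K, (modelClasses M).IsCofibrant X)
include hK

lemma colocalEquivalences_of_weq {A B : T.Algebra} {g : A ⟶ B}
    (hg : (algClasses T (modelClasses M)).weq g) :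
    (algClasses T (modelClasses M)).colocalEquivalences (freeSet T K) g := by
  rintro _ ⟨Z, hZ, rfl⟩
  exact mapWeq_free (mapWeq_of_weakEquivalences (hK Z hZ) hg)

lemma colocalEquivalences_forget {A B : T.Algebra} {g : A ⟶ B}
    (P : (algClasses T (modelClasses M)).MapResolution g)
    (hg : (algClasses T (modelClasses M)).colocalEquivalences (freeSet T K) g) :
    (modelClasses M).colocalEquivalences K (T.forget.map g) := fun Z hZ =>
  (mapWeq_iff (hK Z hZ) P.forget).2 <|
    (sSetWeakEquivalence_homComplexMap_leftAdjoint_iff T.adj Z P.res).1 (hg _ ⟨Z, hZ, rfl⟩ P)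

lemma isColocal_free [HasColimits T.Algebra] {X : M} (hX : (modelClasses M).IsColocal K X) :
    (algClasses T (modelClasses M)).IsColocal (freeSet T K) (T.free.obj X) where
  cofibrant := isCofibrant_free hX.cofibrant
  mapWeq _ _ g hg P :=
    mapWeq_free (hX.mapWeq (T.forget.map g) (colocalEquivalences_forget hK P hg)) P

end Colocal

variable [HasColimits T.Algebra]

lemma weq_free_map_of_trivialCofibrations (hT : IsSemiAdmissible T (modelClasses M)) {X W : M}
    (hX : cofibrations M (initial.to X)) {j : X ⟶ W} (hj : trivialCofibrations M j) :
    (algClasses T (modelClasses M)).weq (T.free.map j) := by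
  obtain ⟨Z, i, p, hi, hp, hip⟩ : ∃ (Z : T.Algebra) (i : T.free.obj X ⟶ Z)
      (p : Z ⟶ T.free.obj W), (algClasses T (modelClasses M)).trivCof i ∧
        (algClasses T (modelClasses M)).fib p ∧ i ≫ p = T.free.map j := by
    obtain ⟨Z, i, p, h⟩ := hT.factor_trivCof
    exact ⟨_, _, _, h ⟨Arrow.mk (T.free.map j), isCofibrant_free hX⟩⟩
  have : HasLiftingProperty (T.free.map j) p := by
    rw [← MorphismProperty.llp_eq_of_wfs (trivialCofibrations M) (fibrations M)] at hj
    exact (T.adj.hasLiftingProperty_iff _ _).2 (hj _ hp)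
  have := hT.weq_retract
  exact MorphismProperty.of_retract (P := (algClasses T (modelClasses M)).weq)
    (RetractArrow.ofLeftLiftingProperty hip) hi.2

lemma weq_free_map_of_weakEquivalences (hT : IsSemiAdmissible T (modelClasses M)) {X Y : M}
    (hX : cofibrations M (initial.to X)) (hY : cofibrations M (initial.to Y)) {f : X ⟶ Y}
    (hf : weakEquivalences M f) : (algClasses T (modelClasses M)).weq (T.free.map f) := by
  have : IsCofibrant X := ⟨hX⟩
  have : IsCofibrant Y := ⟨hY⟩
  have : WeakEquivalence f := ⟨hf⟩
  have := hT.twoOutOfThree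
  let W := (algClasses T (modelClasses M)).weq
  let b : CofibrantBrownFactorization f := Classical.arbitrary _
  have hi : W (T.free.map b.i) := weq_free_map_of_trivialCofibrations hT hX
    ⟨b.hi, mem_weakEquivalences b.i⟩
  have hs : W (T.free.map b.s) := weq_free_map_of_trivialCofibrations hT hY
    ⟨mem_cofibrations b.s, mem_weakEquivalences b.s⟩
  have hp : W (T.free.map b.p) := by
    refine W.of_precomp _ _ hs ?_
    rw [← Functor.map_comp, b.s_p, CategoryTheory.Functor.map_id]
    exact (weakEquivalences M).id_mem _
  rw [← b.fac, Functor.map_comp]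
  exact W.comp_mem _ _ hi hp

end FreeAlgebras

end Colocal

theorem mainTheorem9_general {M : Type u} [Category.{v} M] [HasLimits M] [HasColimits M]
    [ModelCategory M] (T : Monad M) [HasColimits T.Algebra]
    (K : Set M) (hK : ∀ X ∈ K, (Colocal.modelClasses M).IsCofibrant X)
    (hT : Colocal.IsSemiAdmissible T (Colocal.modelClasses M)) {X Y : M} (f : X ⟶ Y)
    (hX : (Colocal.modelClasses M).IsColocal K X) (hY : (Colocal.modelClasses M).IsColocal K Y)
    (hf : (Colocal.modelClasses M).colocalEquivalences K f) :
    (Colocal.algClasses T (Colocal.modelClasses M)).IsColocal (Colocal.freeSet T K)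
        (T.free.obj X) ∧
      (Colocal.algClasses T (Colocal.modelClasses M)).IsColocal (Colocal.freeSet T K)
        (T.free.obj Y) ∧
      (Colocal.algClasses T (Colocal.modelClasses M)).colocalEquivalences (Colocal.freeSet T K)
        (T.free.map f) := by
  have hf_weq : weakEquivalences M f :=
    Colocal.weakEquivalences_of_mapWeq (hX.mapWeq f hf) (hY.mapWeq f hf)
  have hTf_weq : (Colocal.algClasses T (Colocal.modelClasses M)).weq (T.free.map f) :=
    Colocal.weq_free_map_of_weakEquivalences hT hX.cofibrant hY.cofibrant hf_weq
  exact ⟨Colocal.isColocal_free hK hX, Colocal.isColocal_free hK hY,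
    Colocal.colocalEquivalences_of_weq hK hTf_weq⟩

theorem mainTheorem9 {M : Type u} [Category.{v} M] [HasLimits M] [HasColimits M]
    [ModelCategory M]
    (T : Monad M) [HasColimits T.Algebra]
    (K : Set M) (hK : ∀ X ∈ K, (Colocal.modelClasses M).IsCofibrant X)
    (hRK : ((Colocal.modelClasses M).rightBousfield K).IsModel)
    (hT : Colocal.IsSemiAdmissible T (Colocal.modelClasses M))
    (h : Colocal.IsSemiAdmissible T ((Colocal.modelClasses M).rightBousfield K) ∨
      Colocal.HasFreeRightBousfield T (Colocal.modelClasses M) K)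
    {X Y : M} (f : X ⟶ Y)
    (hX : (Colocal.modelClasses M).IsColocal K X)
    (hY : (Colocal.modelClasses M).IsColocal K Y)
    (hf : (Colocal.modelClasses M).colocalEquivalences K f) :
    (Colocal.algClasses T (Colocal.modelClasses M)).IsColocal (Colocal.freeSet T K)
        (T.free.obj X) ∧
      (Colocal.algClasses T (Colocal.modelClasses M)).IsColocal (Colocal.freeSet T K)
        (T.free.obj Y) ∧
      (Colocal.algClasses T (Colocal.modelClasses M)).colocalEquivalences (Colocal.freeSet T K)
        (T.free.map f) :=
  mainTheorem9_general T K hK hT f hX hY hf
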